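/- **Definitions.** A mixed graph $D=(V,A,E)$ has a nonempty finite vertex set $V$, a set $A$ of arcs (ordered pairs of distinct vertices, written $u\to v$) and a set $E$ of undirected edges, such that each pair of distinct vertices is joined by at most one of: an arc $u\to v$, an arc $v\to u$, an undirected edge. It is connected if its underlying simple graph is. An oriented graph is a mixed graph with $E=\emptyset$. Let $\omega=\frac{1+i\sqrt3}{2}$. The Hermitian adjacency matrix $H_\omega(D)$ has $(u,v)$ entry $\omega$ if $u\to v$, $\overline\omega$ if $v\to u$, $1$ if $\{u,v\}\in E$, and $0$ otherwise. **Theorem.** If $D$ is a connected mixed graph and $H_\omega(D)$ has exactly two distinct eigenvalues, then, up to isomorphism, $D$ is one of the following. (a) A mixed graph on $n\ge 2$ vertices whose underlying graph is the complete graph $K_n$ and which is cospectral with the undirected complete graph $K_n$, that is, $H_\omega(D)$ and $H_\omega(K_n)$ have the same characteristic polynomial. (b) The mixed 4-cycle consisting of a directed path of length three $0\to1\to2\to3$ and one undirected edge $\{3,0\}$. (c) One of the following four oriented graphs: - the directed edge $0\to 1$, with eigenvalues $\{1,-1\}$; - the directed triangle $0\to1\to2\to0$, with eigenvalues $\{1,-2\}$;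 - the orientation of $K_{3,3}$ with parts $\{0,1,2\}$ and $\{3,4,5\}$ and arcs $0\to3$, $0\to4$, $1\to4$, $1\to5$, $2\to3$, $2\to5$, $3\to1$, $4\to2$, $5\to0$, with eigenvalues $\{\sqrt3,-\sqrt3\}$; - the orientation of $K_{5,5}$ minus a perfect matching with parts $\{0,1,2,3,4\}$ and $\{5,6,7,8,9\}$, removed matching $\{i,i+5\}$ $(0\le i\le 4)$, and arcs $0\to6$, $0\to7$, $1\to5$, $1\to9$, $2\to5$, $2\to8$, $3\to7$, $3\to9$, $4\to6$, $4\to8$, $5\to3$, $5\to4$, $6\to2$, $6\to3$, $7\to1$, $7\to4$, $8\to0$, $8\to1$, $9\to0$, $9\to2$, with eigenvalues $\{2,-2\}$. -/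

import Mathlib

/-- A mixed graph on the vertex set `V`: directed arcs `u → v` and undirected edges, without loops;
each pair of distinct vertices is joined by at most one object (an arc in one of the two directions,
or an undirected edge). -/
structure MixedGraph (V : Type*) where
  /-- `arc u v` means `u → v`. -/
  arc : V → V → Prop
  /-- The undirected edges. -/
  edge : SimpleGraph V
  /-- At most one of `u → v`, `v → u` holds; in particular there are no loops. -/
  arc_asymm : ∀ u v, arc u v → ¬ arc v u
  arc_not_edge : ∀ u v, arc u v → ¬ edge.Adj u v

namespace MixedGraph

/-- The underlying simple graph. -/
def underlying {V : Type*} (D : MixedGraph V) : SimpleGraph V where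
  Adj u v := D.arc u v ∨ D.arc v u ∨ D.edge.Adj u v
  symm := ⟨fun _ _ h => h.elim (fun h => Or.inr (Or.inl h))
    (fun h => h.elim Or.inl (fun h => Or.inr (Or.inr h.symm)))⟩
  loopless := ⟨fun u h => h.elim (fun h => D.arc_asymm u u h h)
    (fun h => h.elim (fun h => D.arc_asymm u u h h) (fun h => D.edge.irrefl h))⟩

/-- A mixed graph is connected if its underlying graph is. -/
def Connected {V : Type*} (D : MixedGraph V) : Prop := D.underlying.Connected

/-- The primitive sixth root of unity `ω = (1 + i√3) / 2`. -/
noncomputable def omega : ℂ := (1 + Complex.I * (Real.sqrt 3 : ℂ)) / 2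

open Classical in
/-- The Hermitian adjacency matrix of the second kind `H_ω(D)`. -/
noncomputable def hermAdj {V : Type*} (D : MixedGraph V) : Matrix V V ℂ :=
  Matrix.of fun u v =>
    if D.arc u v then omega
    else if D.arc v u then star omega
    else if D.edge.Adj u v then 1
    else 0

/-- `D` and `D'` are isomorphic: a bijection of the vertices preserves and reflects arcs (with their
directions) and undirected edges. -/
def IsIsomorphic {V W : Type*} (D : MixedGraph V) (D' : MixedGraph W) : Prop :=
  ∃ e : V ≃ W, (∀ u v, D.arc u v ↔ D'.arc (e u) (e v)) ∧
    (∀ u v, D.edge.Adj u v ↔ D'.edge.Adj (e u) (e v))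

/-- An undirected graph, seen as a mixed graph without arcs. -/
def ofGraph {V : Type*} (G : SimpleGraph V) : MixedGraph V where
  arc _ _ := False
  edge := G
  arc_asymm _ _ h := h.elim
  arc_not_edge _ _ h := h.elim

/-- The oriented graph (no undirected edges) with a given list of arcs. -/
def ofArcs {n : ℕ} (l : List (Fin n × Fin n)) (h : ∀ u v, (u, v) ∈ l → (v, u) ∉ l) :
    MixedGraph (Fin n) where
  arc u v := (u, v) ∈ l
  edge := ⊥
  arc_asymm := h
  arc_not_edge _ _ _ h := h

/-- The 4-cycle `0 → 1 → 2 → 3 — 0`: a directed path of length three closed by one undirected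
edge. -/
def mixedFourCycle : MixedGraph (Fin 4) where
  arc u v := (u, v) ∈ [((0 : Fin 4), (1 : Fin 4)), (1, 2), (2, 3)]
  edge := SimpleGraph.fromEdgeSet {s(3, 0)}
  arc_asymm := by decide
  arc_not_edge := by
    simp only [SimpleGraph.fromEdgeSet_adj, Set.mem_singleton_iff]
    decide

/-- The directed edge `0 → 1`. -/
def directedEdge : MixedGraph (Fin 2) := ofArcs [(0, 1)] (by decide)

/-- The directed triangle `0 → 1 → 2 → 0`. -/
def directedTriangle : MixedGraph (Fin 3) := ofArcs [(0, 1), (1, 2), (2, 0)] (by decide)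

/-- The special orientation of `K_{3,3}`, with parts `{0, 1, 2}` and `{3, 4, 5}`. -/
def specialK33 : MixedGraph (Fin 6) :=
  ofArcs
    [(0, 3), (0, 4), (1, 4), (1, 5), (2, 3), (2, 5),
     (3, 1), (4, 2), (5, 0)] (by decide)

/-- The special orientation of `K_{5,5}` minus a perfect matching, with parts `{0, 1, 2, 3, 4}` and
`{5, 6, 7, 8, 9}` and removed matching `{i, i + 5}`. -/
def specialK55 : MixedGraph (Fin 10) :=
  ofArcs
    [(0, 6), (0, 7), (1, 5), (1, 9), (2, 5), (2, 8), (3, 7), (3, 9), (4, 6), (4, 8),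
     (5, 3), (5, 4), (6, 2), (6, 3), (7, 1), (7, 4), (8, 0), (8, 1), (9, 0), (9, 2)] (by decide)

end MixedGraph

/-! ### Hermitian matrices with two eigenvalues. -/

namespace MixedGraph
section Spectral

variable {ι : Type*} [Fintype ι] [DecidableEq ι] {M : Matrix ι ι ℂ}

/-! Two eigenvalues `s < t` mean `H ^ 2 = a • H + k • 1` with `a = t + s` and `k = -(t * s)`. Since
`1, ω` are independent over the reals, this splits entrywise into two systems of integer equations
(`WalkEquations`). They show that `a` and `k` are integers and that the underlying graph is
`k`-regular.

Evaluating `H ^ 2 - a • H - k • 1` on the all-ones vector bounds the degree: if `e`, `o`, `i` count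
edges, out-arcs and in-arcs at a vertex, the sum over all vertices of `(k + e - 2 * t) * (k + e - 2
* s) + 3 * (o - i) ^ 2` is zero, so `k ≤ 2 * t`, that is, `s ≥ -2`. As `H` has trace zero, `a = 0`
or `s` is an integer. This leaves `s = -1`, `s = -2`, or `a = 0` with `k = 2` or `k = 3`
(`WalkEquations.parameters`).

If `s = -1`, adjacent vertices have at least `k - 1` common neighbours, so the graph is complete,
and the zero trace fixes the multiplicities. If `s = -2`, the vanishing sum kills all edges and
balances in- and out-degrees; double counting excludes transitive triangles
(`WalkEquations.not_transitive`), which leaves `a = -1` (the triangle) and `a = 0`, `k = 4`. For `a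
= 0`, `k = 2`, a local count finds the mixed 4-cycle. For `a = 0` and `k = 3` or `4` there are no
edges, and two vertices with a common neighbour are joined by exactly one 2-path of each kind
(`WalkEquations.uniquePaths`). This rigidity determines the graph around any suitable vertex, and
regularity with connectedness shows that nothing lies outside the configuration found
(`isIsomorphic_of_injective`). -/

theorem exists_eigenvalue_pair (hM : M.IsHermitian) (h : (spectrum ℂ M).ncard = 2) :
    ∃ s t : ℝ, s < t ∧ spectrum ℂ M = {(t : ℂ), (s : ℂ)} ∧
      ∀ i, hM.eigenvalues i = t ∨ hM.eigenvalues i = s := by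
  have hs : spectrum ℂ M = Complex.ofReal '' Set.range hM.eigenvalues := hM.spectrum_eq_image_range
  rw [hs, Set.ncard_image_of_injective _ Complex.ofReal_injective, Set.ncard_eq_two] at h
  obtain ⟨x, y, hxy, h⟩ := h
  have hmem : ∀ i, hM.eigenvalues i = x ∨ hM.eigenvalues i = y := fun i => by
    have : hM.eigenvalues i ∈ Set.range hM.eigenvalues := ⟨i, rfl⟩
    simpa [h] using this
  rcases lt_or_gt_of_ne hxy with hlt | hlt
  · exact ⟨x, y, hlt, by rw [hs, h, Set.pair_comm, Set.image_pair], fun i => (hmem i).symm⟩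
  · exact ⟨y, x, hlt, by rw [hs, h, Set.image_pair], hmem⟩

/-- `(M - t) * (M - s)` kills every vector of an eigenbasis. -/
theorem mul_self_of_eigenvalues (hM : M.IsHermitian) {s t : ℝ}
    (h : ∀ i, hM.eigenvalues i = t ∨ hM.eigenvalues i = s) :
    M * M = ((t + s : ℝ) : ℂ) • M - ((t * s : ℝ) : ℂ) • 1 := by
  have hfac : (M - (t : ℂ) • 1) * (M - (s : ℂ) • 1) = 0 := by
    apply Matrix.toEuclideanLin.injective
    apply hM.eigenvectorBasis.toBasis.ext
    intro i
    have hv := hM.mulVec_eigenvectorBasis i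
    simp only [OrthonormalBasis.coe_toBasis, map_zero, LinearMap.zero_apply]
    ext1
    have hw : ∀ c : ℂ, (M - c • 1).mulVec (hM.eigenvectorBasis i).ofLp =
        ((hM.eigenvalues i : ℂ) - c) • (hM.eigenvectorBasis i).ofLp := fun c => by
      rw [Matrix.sub_mulVec, hv, Matrix.smul_mulVec, Matrix.one_mulVec, sub_smul,
        Complex.coe_smul]
    rw [Matrix.ofLp_toLpLin, Matrix.toLin'_apply, ← Matrix.mulVec_mulVec, hw, Matrix.mulVec_smul,
      hw, smul_smul]
    rcases h i with h | h <;> simp [h]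
  have : M * M - (((t + s : ℝ) : ℂ) • M - ((t * s : ℝ) : ℂ) • 1) =
      (M - (t : ℂ) • 1) * (M - (s : ℂ) • 1) := by
    simp only [sub_mul, mul_sub, Matrix.smul_mul, Matrix.mul_smul, Matrix.mul_one, Matrix.one_mul,
      Complex.ofReal_add, Complex.ofReal_mul, add_smul, smul_smul]
    rw [mul_comm (s : ℂ)]
    abel
  rwa [hfac, sub_eq_zero] at this

theorem eigenvalues_of_mul_self (hM : M.IsHermitian) {s t : ℝ}
    (h : M * M = ((t + s : ℝ) : ℂ) • M - ((t * s : ℝ) : ℂ) • 1) (i : ι) :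
    hM.eigenvalues i = t ∨ hM.eigenvalues i = s := by
  have hv := hM.mulVec_eigenvectorBasis i
  have h2 := congrArg (fun A => Matrix.mulVec A (hM.eigenvectorBasis i).ofLp) h
  simp only [← Matrix.mulVec_mulVec, Matrix.sub_mulVec, Matrix.smul_mulVec, Matrix.one_mulVec, hv,
    Matrix.mulVec_smul] at h2
  have hne : (hM.eigenvectorBasis i).ofLp ≠ 0 := by
    intro h0
    have := hM.eigenvectorBasis.orthonormal.ne_zero i
    exact this (by ext j; simp [h0])
  obtain ⟨j, hj⟩ := Function.ne_iff.mp hne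
  have h3 := congrFun h2 j
  simp only [Pi.sub_apply, Pi.smul_apply, smul_eq_mul, Complex.real_smul, Pi.zero_apply] at h3 hj
  have h4 : ((hM.eigenvalues i - t) * (hM.eigenvalues i - s) : ℂ) = 0 := by
    apply mul_right_cancel₀ hj
    push_cast at h3
    linear_combination h3
  have h5 : (hM.eigenvalues i - t) * (hM.eigenvalues i - s) = 0 := by exact_mod_cast h4
  rcases mul_eq_zero.mp h5 with h | h
  · exact Or.inl (by linarith)
  · exact Or.inr (by linarith)

open Classical in
theorem sum_eigenvalues_of_trace_eq_zero (hM : M.IsHermitian) (htr : M.trace = 0) {s t : ℝ}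
    (h : ∀ i, hM.eigenvalues i = t ∨ hM.eigenvalues i = s) :
    ∃ m : Finset ι, (∀ i, hM.eigenvalues i = if i ∈ m then t else s) ∧
      (m.card : ℝ) * t + (mᶜ.card : ℝ) * s = 0 := by
  have heig : ∀ i, hM.eigenvalues i =
      if i ∈ Finset.univ.filter (fun i => hM.eigenvalues i = t) then t else s := by
    intro i
    by_cases hi : hM.eigenvalues i = t
    · simp [hi]
    · simpa [hi] using (h i).resolve_left hi
  refine ⟨_, heig, ?_⟩
  have h1 := hM.trace_eq_sum_eigenvalues
  rw [htr] at h1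
  have h2 : ∑ i, hM.eigenvalues i = 0 := by
    rw [← Complex.ofReal_inj, Complex.ofReal_sum]; exact h1.symm
  rw [Finset.sum_congr rfl (fun i _ => heig i), Finset.sum_ite] at h2
  simp only [Finset.sum_const, nsmul_eq_mul] at h2
  rwa [Finset.filter_mem_eq_inter, Finset.univ_inter, Finset.filter_notMem_eq_sdiff,
    ← Finset.compl_eq_univ_sdiff] at h2

/-- If the eigenvalues of a traceless Hermitian matrix lie in `{t, s}` and `t + s` and `t * s` are
integers, then `s = -t` or `s` is an integer. -/
theorem eigenvalue_integral [Nonempty ι] (hM : M.IsHermitian) (htr : M.trace = 0) {s t : ℝ}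
    (h : ∀ i, hM.eigenvalues i = t ∨ hM.eigenvalues i = s) {a k : ℤ} (ha : t + s = a)
    (hk : t * s = -k) : a = 0 ∨ ∃ z : ℤ, s = z := by
  obtain ⟨m, -, hm⟩ := sum_eigenvalues_of_trace_eq_zero hM htr h
  by_cases hcard : (m.card : ℝ) = (mᶜ.card : ℝ)
  · left
    have h0 : (m.card : ℝ) * (t + s) = 0 := by rw [← hcard] at hm; linarith
    rcases mul_eq_zero.mp h0 with h0 | h0
    · rw [h0] at hcard
      have h1 : m.card + mᶜ.card = Fintype.card ι := Finset.card_add_card_compl m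
      have h2 : m.card = 0 := by exact_mod_cast h0
      have h3 : mᶜ.card = 0 := by exact_mod_cast hcard.symm
      have := Fintype.card_pos (α := ι)
      omega
    · rw [ha] at h0; exact_mod_cast h0
  · right
    have hne : (m.card : ℝ) - (mᶜ.card : ℝ) ≠ 0 := sub_ne_zero.mpr hcard
    -- Unequal multiplicities allow the trace equation, with `t = a - s`, to be solved for `s`. The
    -- rational solution is a root of the monic integer polynomial `X ^ 2 - a * X - k`, hence an
    -- integer.
    set q : ℚ := (m.card : ℚ) * a / ((m.card : ℚ) - (mᶜ.card : ℚ)) with hq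
    have hs : s = (q : ℝ) := by
      rw [hq]; push_cast
      rw [eq_div_iff hne]
      have : t = a - s := by linarith
      rw [this] at hm
      linarith
    have hroot : q ^ 2 - a * q - k = 0 := by
      have : (q : ℝ) ^ 2 - a * q - k = 0 := by
        rw [← hs]
        have : t = a - s := by linarith
        rw [this] at hk
        nlinarith
      exact_mod_cast this
    have hint : IsIntegral ℤ q := by
      refine ⟨Polynomial.X ^ 2 - (Polynomial.C a * Polynomial.X + Polynomial.C k), ?_, ?_⟩
      · apply Polynomial.monic_X_pow_sub
        compute_degree!
      · simp only [Polynomial.eval₂_sub, Polynomial.eval₂_pow, Polynomial.eval₂_X,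
          Polynomial.eval₂_add, Polynomial.eval₂_mul, Polynomial.eval₂_C]
        simp only [algebraMap_int_eq, eq_intCast]
        linarith
    obtain ⟨z, hz⟩ := IsIntegrallyClosed.isIntegral_iff.mp hint
    refine ⟨z, ?_⟩
    rw [hs, ← hz]
    simp

-- The eigenvalues are `k` and `-1`; zero trace in dimension `k + 1` forces `k` to be simple.
open Polynomial in
theorem charpoly_of_mul_self (hM : M.IsHermitian) (htr : M.trace = 0) {k : ℕ}
    (hcard : Fintype.card ι = k + 1)
    (h : M * M = (((k : ℝ) + (-1 : ℝ) : ℝ) : ℂ) • M - (((k : ℝ) * (-1 : ℝ) : ℝ) : ℂ) • 1) :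
    M.charpoly = (X - C (k : ℂ)) * (X + 1) ^ k := by
  classical
  obtain ⟨m, heig, hm⟩ := sum_eigenvalues_of_trace_eq_zero hM htr (eigenvalues_of_mul_self hM h)
  have h1 : m.card + mᶜ.card = k + 1 := by rw [← hcard]; exact Finset.card_add_card_compl m
  have h2 : m.card * k = mᶜ.card := by
    have : (m.card : ℝ) * k = mᶜ.card := by linarith
    exact_mod_cast this
  have h3 : m.card = 1 := by
    have : m.card * (k + 1) = 1 * (k + 1) := by rw [mul_add, h2]; omega
    exact Nat.eq_of_mul_eq_mul_right (Nat.succ_pos k) this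
  have h4 : mᶜ.card = k := by omega
  rw [hM.charpoly_eq, Finset.prod_congr rfl (fun i _ => by rw [heig i]),
    ← Finset.prod_mul_prod_compl m, Finset.prod_congr rfl (g := fun _ => X - C (k : ℂ)),
    Finset.prod_congr (s₁ := mᶜ) rfl (g := fun _ => X + 1)]
  · simp [h3, h4]
  · intro i hi
    simp [Finset.mem_compl.mp hi]
  · intro i hi
    simp [hi]

end Spectral
end MixedGraph

/-! ### Integer equations for the entries of the squared matrix. -/

namespace MixedGraph
section Walks

variable {V : Type*} (D : MixedGraph V)

open Classical in
/-- Indicator of the arc `u → v`. -/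
noncomputable def arcInd (u v : V) : ℤ := if D.arc u v then 1 else 0

open Classical in
/-- Indicator of the undirected edge `{u, v}`. -/
noncomputable def edgeInd (u v : V) : ℤ := if D.edge.Adj u v then 1 else 0

/-- Indicator of adjacency in the underlying graph. -/
noncomputable def adjInd (u v : V) : ℤ := D.edgeInd u v + D.arcInd u v + D.arcInd v u

variable {D}

theorem arcInd_eq_one {u v : V} : D.arcInd u v = 1 ↔ D.arc u v := by
  simp [arcInd]

theorem arcInd_of_arc {u v : V} (h : D.arc u v) : D.arcInd u v = 1 := arcInd_eq_one.mpr h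

theorem arcInd_of_not_arc {u v : V} (h : ¬ D.arc u v) : D.arcInd u v = 0 := by
  simp [arcInd, h]

theorem edgeInd_of_adj {u v : V} (h : D.edge.Adj u v) : D.edgeInd u v = 1 := by
  simp [edgeInd, h]

theorem edgeInd_of_not_adj {u v : V} (h : ¬ D.edge.Adj u v) : D.edgeInd u v = 0 := by
  simp [edgeInd, h]

theorem edgeInd_of_edge_eq_bot (h : D.edge = ⊥) (u v : V) : D.edgeInd u v = 0 :=
  edgeInd_of_not_adj (by simp [h])

theorem edgeInd_comm (u v : V) : D.edgeInd u v = D.edgeInd v u := by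
  have := D.edge.adj_comm u v
  unfold edgeInd; split_ifs <;> simp_all

theorem adjInd_comm (u v : V) : D.adjInd u v = D.adjInd v u := by
  rw [adjInd, adjInd, edgeInd_comm]; ring

theorem ind_cases (D : MixedGraph V) (u v : V) :
    (D.edgeInd u v = 0 ∧ D.arcInd u v = 0 ∧ D.arcInd v u = 0) ∨
    (D.edgeInd u v = 1 ∧ D.arcInd u v = 0 ∧ D.arcInd v u = 0) ∨
    (D.edgeInd u v = 0 ∧ D.arcInd u v = 1 ∧ D.arcInd v u = 0) ∨
    (D.edgeInd u v = 0 ∧ D.arcInd u v = 0 ∧ D.arcInd v u = 1) := by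
  have h1 := D.arc_asymm u v
  have h2 := D.arc_not_edge u v
  have h3 := D.arc_not_edge v u
  rw [D.edge.adj_comm] at h3
  unfold edgeInd arcInd
  split_ifs <;> simp_all

theorem arcInd_nonneg (u v : V) : 0 ≤ D.arcInd u v := by
  unfold arcInd; split_ifs <;> simp

theorem edgeInd_nonneg (u v : V) : 0 ≤ D.edgeInd u v := by
  unfold edgeInd; split_ifs <;> simp

theorem arcInd_self (u : V) : D.arcInd u u = 0 :=
  arcInd_of_not_arc fun h => D.arc_asymm u u h h

theorem edgeInd_self (u : V) : D.edgeInd u u = 0 :=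
  edgeInd_of_not_adj D.edge.irrefl

theorem adjInd_self (u : V) : D.adjInd u u = 0 := by
  simp [adjInd, arcInd_self, edgeInd_self]

theorem adjInd_nonneg (u v : V) : 0 ≤ D.adjInd u v := by
  have := edgeInd_nonneg (D := D) u v
  have := arcInd_nonneg (D := D) u v
  have := arcInd_nonneg (D := D) v u
  unfold adjInd; omega

theorem adjInd_le_one (u v : V) : D.adjInd u v ≤ 1 := by
  have := D.ind_cases u v
  unfold adjInd; omega

theorem adjInd_eq_one {u v : V} : D.adjInd u v = 1 ↔ D.underlying.Adj u v := by
  have h1 := D.arc_asymm u v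
  have h2 := D.arc_not_edge u v
  have h3 := D.arc_not_edge v u
  rw [D.edge.adj_comm] at h3
  change _ ↔ D.arc u v ∨ D.arc v u ∨ D.edge.Adj u v
  unfold adjInd edgeInd arcInd
  split_ifs <;> simp_all

theorem adjInd_eq_zero {u v : V} : D.adjInd u v = 0 ↔ ¬ D.underlying.Adj u v := by
  rw [← adjInd_eq_one]
  have := adjInd_nonneg (D := D) u v
  have := adjInd_le_one (D := D) u v
  omega

theorem star_omega : star omega = 1 - omega := by
  apply Complex.ext <;> simp [omega] <;> ring

theorem omega_mul_omega : omega * omega = omega - 1 := by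
  have h : ((Real.sqrt 3 : ℝ) : ℂ) * (Real.sqrt 3 : ℝ) = 3 := by
    rw [← Complex.ofReal_mul, Real.mul_self_sqrt (by norm_num)]; simp
  unfold omega
  linear_combination (1/4) * Complex.I ^ 2 * h + (3/4) * Complex.I_sq

theorem add_omega_mul_inj {x y z w : ℝ} (h : (x : ℂ) + omega * y = z + omega * w) :
    x = z ∧ y = w := by
  have h1 := congrArg Complex.im h
  have h2 := congrArg Complex.re h
  simp [omega] at h1 h2
  rw [h1] at h2
  exact ⟨by linarith, h1⟩

/-- Coordinates in the basis `1, ω`, using `star ω = 1 - ω`: a reversed arc contributes to both. -/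
theorem hermAdj_apply (u v : V) : D.hermAdj u v =
    ((D.edgeInd u v + D.arcInd v u : ℤ) : ℂ) + omega * ((D.arcInd u v - D.arcInd v u : ℤ) : ℂ) := by
  have h1 := D.arc_asymm u v
  have h2 := D.arc_not_edge u v
  have h3 := D.arc_not_edge v u
  rw [D.edge.adj_comm] at h3
  have h4 := star_omega
  simp only [hermAdj, Matrix.of_apply]
  unfold edgeInd arcInd
  split_ifs <;> simp_all
  ring

theorem isHermitian_hermAdj : D.hermAdj.IsHermitian := by
  ext u v
  rw [Matrix.conjTranspose_apply, hermAdj_apply, hermAdj_apply, star_add, star_mul, star_omega,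
    edgeInd_comm v u]
  simp
  ring

variable [Fintype V]

theorem trace_hermAdj : D.hermAdj.trace = 0 := by
  simp [Matrix.trace, hermAdj_apply, arcInd_self, edgeInd_self]

/-- The rational part of the `(u, v)` entry of `H_ω(D) ^ 2` in the basis `1, ω`. -/
noncomputable def walkRat (D : MixedGraph V) (u v : V) : ℤ :=
  ∑ w, (D.edgeInd u w * D.edgeInd w v + D.arcInd u w * D.arcInd v w + D.arcInd w u * D.arcInd w v
    + D.edgeInd u w * D.arcInd v w + D.arcInd w u * D.edgeInd w v - D.arcInd u w * D.arcInd w v)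

/-- The coefficient of `ω` in the `(u, v)` entry of `H_ω(D) ^ 2` in the basis `1, ω`. -/
noncomputable def walkOmega (D : MixedGraph V) (u v : V) : ℤ :=
  ∑ w, (D.arcInd u w * D.edgeInd w v + D.edgeInd u w * D.arcInd w v - D.edgeInd u w * D.arcInd v w
    - D.arcInd w u * D.edgeInd w v + D.arcInd u w * D.arcInd w v - D.arcInd w u * D.arcInd v w)

theorem hermAdj_mul_self_apply (u v : V) : (D.hermAdj * D.hermAdj) u v =
    (D.walkRat u v : ℂ) + omega * (D.walkOmega u v : ℂ) := by
  rw [Matrix.mul_apply, walkRat, walkOmega, Int.cast_sum, Int.cast_sum, Finset.mul_sum,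
    ← Finset.sum_add_distrib]
  refine Finset.sum_congr rfl fun w _ => ?_
  rw [hermAdj_apply, hermAdj_apply]
  push_cast
  linear_combination ((D.arcInd u w : ℂ) - D.arcInd w u) * ((D.arcInd w v : ℂ) - D.arcInd v w) *
    omega_mul_omega

theorem walkRat_self (u : V) : D.walkRat u u = ∑ w, D.adjInd u w := by
  refine Finset.sum_congr rfl fun w _ => ?_
  rw [edgeInd_comm w u, adjInd]
  rcases D.ind_cases u w with ⟨h1, h2, h3⟩ | ⟨h1, h2, h3⟩ | ⟨h1, h2, h3⟩ | ⟨h1, h2, h3⟩ <;>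
    rw [h1, h2, h3] <;> norm_num

variable [DecidableEq V]

variable (D) in
/-- The entrywise form of `H_ω(D) ^ 2 = a • H_ω(D) + k • 1`. -/
structure WalkEquations (a k : ℤ) : Prop where
  rat : ∀ u v, D.walkRat u v =
    a * (D.edgeInd u v + D.arcInd v u) + if u = v then k else 0
  omega : ∀ u v, D.walkOmega u v = a * (D.arcInd u v - D.arcInd v u)

theorem exists_walkEquations {x y : ℝ} {u v : V} (huv : D.underlying.Adj u v)
    (h : D.hermAdj * D.hermAdj = (x : ℂ) • D.hermAdj - (y : ℂ) • 1) :
    ∃ a k : ℤ, x = a ∧ y = -k ∧ D.WalkEquations a k := by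
  have key : ∀ u v, (D.walkRat u v : ℝ) =
      x * (D.edgeInd u v + D.arcInd v u) - (if u = v then y else 0) ∧
      (D.walkOmega u v : ℝ) = x * (D.arcInd u v - D.arcInd v u) := by
    intro u v
    apply add_omega_mul_inj
    have h1 := congrFun (congrFun h u) v
    rw [hermAdj_mul_self_apply] at h1
    simp only [Matrix.sub_apply, Matrix.smul_apply, hermAdj_apply, Matrix.one_apply,
      smul_eq_mul] at h1
    push_cast at h1 ⊢
    rw [h1]
    split_ifs <;> simp <;> ring
  have hx : ∃ a : ℤ, x = a := by
    have : ∃ u v, D.edgeInd u v + D.arcInd v u = 1 ∧ u ≠ v := by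
      have hne := huv.ne
      rcases huv with huv | huv | huv
      · refine ⟨v, u, ?_, hne.symm⟩
        have := D.ind_cases v u
        have := arcInd_of_arc huv
        omega
      · refine ⟨u, v, ?_, hne⟩
        have := D.ind_cases u v
        have := arcInd_of_arc huv
        omega
      · refine ⟨u, v, ?_, hne⟩
        have := D.ind_cases u v
        have := edgeInd_of_adj huv
        omega
    obtain ⟨u, v, h1, h2⟩ := this
    refine ⟨D.walkRat u v, ?_⟩
    have h3 : (D.edgeInd u v : ℝ) + D.arcInd v u = 1 := by exact_mod_cast h1
    rw [(key u v).1, h3, if_neg h2]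
    ring
  obtain ⟨a, rfl⟩ := hx
  have hy : y = -(D.walkRat u u : ℤ) := by
    rw [(key u u).1]
    simp [arcInd_self, edgeInd_self]
  refine ⟨a, D.walkRat u u, rfl, hy, ⟨fun u' v' => ?_, fun u' v' => ?_⟩⟩
  · have := (key u' v').1
    rw [hy] at this
    have h2 : (D.walkRat u' v' : ℝ) = ((a * (D.edgeInd u' v' + D.arcInd v' u') +
        if u' = v' then D.walkRat u u else 0 : ℤ) : ℝ) := by
      rw [this]; push_cast; split_ifs <;> simp
    exact_mod_cast h2
  · have := (key u' v').2
    exact_mod_cast this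

end Walks
end MixedGraph

/-! ### Degree bounds, possible parameters, and the complete case. -/

namespace MixedGraph
section Degrees

variable {V : Type*} [Fintype V] {D : MixedGraph V}

/-- Number of undirected edges at `w`. -/
noncomputable def edgeDeg (D : MixedGraph V) (w : V) : ℤ := ∑ u, D.edgeInd w u

/-- Number of arcs leaving `w`. -/
noncomputable def outDeg (D : MixedGraph V) (w : V) : ℤ := ∑ u, D.arcInd w u

/-- Number of arcs entering `w`. -/
noncomputable def inDeg (D : MixedGraph V) (w : V) : ℤ := ∑ u, D.arcInd u w

theorem edgeDeg_nonneg (w : V) : 0 ≤ D.edgeDeg w := Finset.sum_nonneg fun _ _ => edgeInd_nonneg _ _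

theorem outDeg_nonneg (w : V) : 0 ≤ D.outDeg w := Finset.sum_nonneg fun _ _ => arcInd_nonneg _ _

theorem inDeg_nonneg (w : V) : 0 ≤ D.inDeg w := Finset.sum_nonneg fun _ _ => arcInd_nonneg _ _

theorem sum_outDeg_eq_sum_inDeg : ∑ w, D.outDeg w = ∑ w, D.inDeg w := Finset.sum_comm

/-- The right side sums `|e + ω * o + star ω * i| ^ 2`, the squared moduli of the row sums of `H`,
which is the all-ones quadratic form of `H ^ 2`. -/
theorem sum_walkRat : ∑ u, ∑ v, D.walkRat u v =
    ∑ w, ((D.edgeDeg w + D.inDeg w) * (D.edgeDeg w + D.outDeg w) +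
      (D.outDeg w - D.inDeg w) ^ 2) := by
  unfold walkRat
  rw [Finset.sum_congr rfl (fun u _ => Finset.sum_comm), Finset.sum_comm]
  refine Finset.sum_congr rfl fun w _ => ?_
  simp only [Finset.sum_add_distrib, Finset.sum_sub_distrib, ← Finset.sum_mul_sum]
  have h1 : ∑ u, D.edgeInd u w = D.edgeDeg w :=
    Finset.sum_congr rfl fun u _ => edgeInd_comm u w
  rw [h1]
  change D.edgeDeg w * D.edgeDeg w + D.inDeg w * D.inDeg w + D.outDeg w * D.outDeg w +
    D.edgeDeg w * D.inDeg w + D.outDeg w * D.edgeDeg w - D.inDeg w * D.outDeg w = _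
  ring

theorem walkRat_le (u v : V) : D.walkRat u v ≤ ∑ w, D.adjInd u w * D.adjInd w v := by
  refine Finset.sum_le_sum fun w _ => ?_
  unfold adjInd
  rcases D.ind_cases u w with ⟨h1, h2, h3⟩ | ⟨h1, h2, h3⟩ | ⟨h1, h2, h3⟩ | ⟨h1, h2, h3⟩ <;>
  rcases D.ind_cases w v with ⟨h4, h5, h6⟩ | ⟨h4, h5, h6⟩ | ⟨h4, h5, h6⟩ | ⟨h4, h5, h6⟩ <;>
    rw [h1, h2, h3, h4, h5, h6] <;> norm_num

variable [DecidableEq V] {a k : ℤ}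

theorem WalkEquations.sum_adjInd (h : D.WalkEquations a k) (u : V) : ∑ w, D.adjInd u w = k := by
  rw [← walkRat_self, h.rat, edgeInd_self, arcInd_self]
  simp

theorem WalkEquations.degree_eq (h : D.WalkEquations a k) (u : V) :
    D.edgeDeg u + D.outDeg u + D.inDeg u = k := by
  rw [← h.sum_adjInd u, edgeDeg, outDeg, inDeg, ← Finset.sum_add_distrib, ← Finset.sum_add_distrib]
  rfl

theorem WalkEquations.sum_degree_form (h : D.WalkEquations a k) :
    ∑ w, ((k + D.edgeDeg w) ^ 2 + 3 * (D.outDeg w - D.inDeg w) ^ 2 - 2 * a * (k + D.edgeDeg w)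
      - 4 * k) = 0 := by
  have h1 := D.sum_walkRat
  simp only [h.rat, Finset.sum_add_distrib, Finset.sum_ite_eq, Finset.mem_univ, if_true,
    ← Finset.mul_sum] at h1
  have h2 : ∑ u, ∑ v, D.edgeInd u v = ∑ w, D.edgeDeg w := rfl
  have h3 : ∑ u, ∑ v, D.arcInd v u = ∑ w, D.inDeg w := rfl
  rw [h2, h3] at h1
  have h4 : ∑ w, ((k + D.edgeDeg w) ^ 2 + 3 * (D.outDeg w - D.inDeg w) ^ 2
      - 2 * a * (k + D.edgeDeg w) - 4 * k) =
      ∑ w, (4 * ((D.edgeDeg w + D.inDeg w) * (D.edgeDeg w + D.outDeg w)) +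
        4 * (D.outDeg w - D.inDeg w) ^ 2 - 4 * a * D.edgeDeg w - 2 * a * D.inDeg w
        - 2 * a * D.outDeg w - 4 * k) := by
    refine Finset.sum_congr rfl fun w _ => ?_
    rw [← h.degree_eq w]
    ring
  rw [h4]
  simp only [Finset.sum_sub_distrib, Finset.sum_add_distrib, ← Finset.mul_sum,
    sum_outDeg_eq_sum_inDeg] at h1 ⊢
  linarith

/-- Each summand of the degree form is `(k + e - 2 * t) * (k + e - 2 * s) + 3 * (o - i) ^ 2`. If `k
> 2 * t`, all are positive, yet they sum to zero. -/
theorem WalkEquations.degree_le (h : D.WalkEquations a k) [Nonempty V] {s t : ℝ} (hst : s < t)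
    (ha : t + s = a) (hk : t * s = -k) : (k : ℝ) ≤ 2 * t := by
  by_contra! hlt
  have h1 := h.sum_degree_form
  have h2 : ∑ w, (((k : ℝ) + D.edgeDeg w) ^ 2 + 3 * ((D.outDeg w : ℝ) - D.inDeg w) ^ 2
      - 2 * a * (k + D.edgeDeg w) - 4 * k) = 0 := by exact_mod_cast h1
  refine absurd h2 (ne_of_gt (Finset.sum_pos (fun w _ => ?_) Finset.univ_nonempty))
  have h3 : (0 : ℝ) ≤ D.edgeDeg w := by exact_mod_cast edgeDeg_nonneg w
  have h4 : 0 < ((k : ℝ) + D.edgeDeg w - 2 * t) * (k + D.edgeDeg w - 2 * s) :=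
    mul_pos (by linarith) (by linarith)
  rw [← ha]
  nlinarith [sq_nonneg ((D.outDeg w : ℝ) - D.inDeg w)]

theorem WalkEquations.parameters (h : D.WalkEquations a k) [Nonempty V] (hkpos : 0 < k) {s t : ℝ}
    (hst : s < t) (ha : t + s = a) (hk : t * s = -k) (hint : a = 0 ∨ ∃ z : ℤ, s = z) :
    (s = -1 ∧ t = k ∧ a = k - 1) ∨ (s = -2 ∧ k = 2 * (a + 2)) ∨ (a = 0 ∧ (k = 2 ∨ k = 3)) := by
  have hle := h.degree_le hst ha hk
  have hkr : (0 : ℝ) < k := by exact_mod_cast hkpos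
  have ht : 0 < t := by linarith
  have hs : s < 0 := by
    by_contra! hs
    have := mul_nonneg ht.le hs
    linarith
  have hs2 : -2 ≤ s := by
    by_contra! hs2
    nlinarith
  have one : s = -1 → s = -1 ∧ t = k ∧ a = k - 1 := by
    rintro rfl
    have : t = k := by linarith
    refine ⟨rfl, this, ?_⟩
    have : (a : ℝ) = k - 1 := by rw [← ha, this]; ring
    exact_mod_cast this
  have two : s = -2 → s = -2 ∧ k = 2 * (a + 2) := by
    rintro rfl
    refine ⟨rfl, ?_⟩
    have : (k : ℝ) = 2 * (a + 2) := by rw [← ha]; linarith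
    exact_mod_cast this
  rcases hint with rfl | ⟨z, rfl⟩
  · have hts : t = -s := by push_cast at ha; linarith
    have hks : (k : ℝ) = s ^ 2 := by rw [hts] at hk; linarith
    have hk4 : (k : ℝ) ≤ 4 := by rw [hks]; nlinarith
    have hk4' : k ≤ 4 := by exact_mod_cast hk4
    -- With `a = 0`, `k = s ^ 2`, so `k = 1` and `k = 4` fall under `s = -1` and `s = -2`.
    have : k = 1 ∨ k = 4 ∨ k = 2 ∨ k = 3 := by omega
    rcases this with rfl | rfl | hk
    · left
      apply one
      have : (s - 1) * (s + 1) = 0 := by push_cast at hks; linarith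
      rcases mul_eq_zero.mp this with h | h <;> linarith
    · right; left
      apply two
      have : (s - 2) * (s + 2) = 0 := by push_cast at hks; linarith
      rcases mul_eq_zero.mp this with h | h <;> linarith
    · exact Or.inr (Or.inr ⟨rfl, hk⟩)
  · have h1 : z < 0 := by exact_mod_cast hs
    have h2 : -2 ≤ z := by exact_mod_cast hs2
    have : z = -1 ∨ z = -2 := by omega
    rcases this with rfl | rfl
    · exact Or.inl (one (by norm_num))
    · exact Or.inr (Or.inl (two (by norm_num)))

theorem WalkEquations.le_common (h : D.WalkEquations a k) {u v : V} (huv : D.underlying.Adj u v) :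
    a ≤ ∑ w, D.adjInd u w * D.adjInd w v := by
  -- The rational equation sees `a` only along an edge or a reversed arc; the count is symmetric, so
  -- a forward arc is handled by exchanging the ends.
  have key : ∀ u v, u ≠ v → D.edgeInd u v + D.arcInd v u = 1 →
      a ≤ ∑ w, D.adjInd u w * D.adjInd w v := by
    intro u v hne h1
    have := walkRat_le (D := D) u v
    rwa [h.rat, h1, if_neg hne, mul_one, add_zero] at this
  have h1 := adjInd_eq_one.mpr huv
  unfold adjInd at h1
  have h2 := D.ind_cases u v
  by_cases h3 : D.edgeInd u v + D.arcInd v u = 1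
  · exact key u v huv.ne h3
  · have := key v u huv.ne.symm (by rw [edgeInd_comm]; omega)
    refine this.trans_eq (Finset.sum_congr rfl fun w _ => ?_)
    rw [adjInd_comm v w, adjInd_comm w u, mul_comm]

/-- At most one of the `k` neighbours of `u` is not adjacent to `v`, and `v` itself is already one.
-/
theorem WalkEquations.adj_trans (h : D.WalkEquations (k - 1) k) {u v w : V}
    (huv : D.underlying.Adj u v) (huw : D.underlying.Adj u w) (hne : w ≠ v) :
    D.underlying.Adj w v := by
  by_contra hwv
  have h1 := h.le_common huv
  have h2 := h.sum_adjInd u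
  have h3 : ∑ x, D.adjInd u x * (1 - D.adjInd x v) ≤ 1 := by
    simp only [mul_sub, mul_one, Finset.sum_sub_distrib]
    omega
  have h4 : ∑ x ∈ {v, w}, D.adjInd u x * (1 - D.adjInd x v) ≤
      ∑ x, D.adjInd u x * (1 - D.adjInd x v) := by
    refine Finset.sum_le_sum_of_subset_of_nonneg (Finset.subset_univ _) fun x _ _ => ?_
    have := adjInd_le_one (D := D) x v
    exact mul_nonneg (adjInd_nonneg _ _) (by omega)
  rw [Finset.sum_pair hne.symm, adjInd_self, adjInd_eq_one.mpr huv, adjInd_eq_one.mpr huw,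
    adjInd_eq_zero.mpr hwv] at h4
  omega

theorem WalkEquations.underlying_eq_top (h : D.WalkEquations (k - 1) k) (hconn : D.Connected) :
    D.underlying = ⊤ := by
  have key : ∀ u v, D.underlying.Walk u v → u ≠ v → D.underlying.Adj u v := by
    intro u v p
    induction p with
    | nil => exact fun h => absurd rfl h
    | @cons x y z hxy _ ih =>
      intro hne
      by_cases hyz : y = z
      · exact hyz ▸ hxy
      · exact h.adj_trans (ih hyz) hxy.symm hne
  ext u v
  refine ⟨fun h => h.ne, fun hne => ?_⟩
  obtain ⟨p⟩ := hconn.preconnected u v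
  exact key u v p hne

theorem sum_adjInd_of_eq_top (htop : D.underlying = ⊤) (u : V) :
    ∑ w, D.adjInd u w = Fintype.card V - 1 := by
  have h1 : ∀ w, D.adjInd u w = 1 - if u = w then 1 else 0 := by
    intro w
    split_ifs with huw
    · rw [huw, adjInd_self]; rfl
    · rw [adjInd_eq_one.mpr (by rw [htop]; exact huw)]; rfl
  simp [h1, Finset.sum_sub_distrib]

theorem hermAdj_ofGraph_top {W : Type*} [DecidableEq W] : (ofGraph (⊤ : SimpleGraph W)).hermAdj =
    Matrix.of (fun _ _ : W => (1 : ℂ)) - 1 := by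
  ext u v
  by_cases h : u = v <;> simp [hermAdj, ofGraph, h]

theorem hermAdj_ofGraph_top_mul_self {n : ℕ} (hn : Fintype.card V = n + 1) :
    (ofGraph (⊤ : SimpleGraph V)).hermAdj * (ofGraph (⊤ : SimpleGraph V)).hermAdj =
    (((n : ℝ) + (-1 : ℝ) : ℝ) : ℂ) • (ofGraph (⊤ : SimpleGraph V)).hermAdj
      - (((n : ℝ) * (-1 : ℝ) : ℝ) : ℂ) • 1 := by
  rw [hermAdj_ofGraph_top]
  ext u v
  simp [mul_sub, Matrix.mul_apply, hn, Matrix.one_apply]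
  split_ifs <;> ring

theorem charpoly_eq_of_underlying_eq_top [Nonempty V] (htop : D.underlying = ⊤)
    (hk : ∀ u, ∑ w, D.adjInd u w = k)
    (h : D.hermAdj * D.hermAdj =
      (((k : ℝ) + (-1 : ℝ) : ℝ) : ℂ) • D.hermAdj - (((k : ℝ) * (-1 : ℝ) : ℝ) : ℂ) • 1) :
    D.hermAdj.charpoly = (ofGraph (⊤ : SimpleGraph V)).hermAdj.charpoly := by
  obtain ⟨n, hn⟩ := Nat.exists_eq_add_of_lt (Fintype.card_pos (α := V))
  have hn : Fintype.card V = n + 1 := by omega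
  have hkn : k = n := by
    rw [← hk (Classical.arbitrary V), sum_adjInd_of_eq_top htop, hn]
    push_cast; ring
  subst hkn
  rw [charpoly_of_mul_self isHermitian_hermAdj trace_hermAdj hn (by exact_mod_cast h),
    charpoly_of_mul_self isHermitian_hermAdj trace_hermAdj hn (hermAdj_ofGraph_top_mul_self hn)]

end Degrees
end MixedGraph

/-! ### A degree criterion for isomorphism. -/

namespace MixedGraph
section Isomorphism

/-- An injective homomorphism from a mixed graph with all degrees at least `k` to a connected mixed
graph with all degrees at most `k` is an isomorphism. -/
theorem isIsomorphic_of_injective {V W : Type*} [Fintype V] [Fintype W] [Nonempty W]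
    {D : MixedGraph V} {D' : MixedGraph W} (hconn : D.Connected) {k : ℕ}
    (hD : ∀ u, ∑ v, D.adjInd u v ≤ k) (f : W → V) (hf : Function.Injective f)
    (s : W → Finset W) (hs : ∀ i, k ≤ (s i).card) (hs' : ∀ i, ∀ j ∈ s i, D'.underlying.Adj i j)
    (harc : ∀ i j, D'.arc i j → D.arc (f i) (f j))
    (hedge : ∀ i j, D'.edge.Adj i j → D.edge.Adj (f i) (f j)) : D.IsIsomorphic D' := by
  classical
  have hadj : ∀ i j, D'.underlying.Adj i j → D.underlying.Adj (f i) (f j) := fun i j h =>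
    h.elim (fun h => Or.inl (harc _ _ h))
      (fun h => h.elim (fun h => Or.inr (Or.inl (harc _ _ h)))
        (fun h => Or.inr (Or.inr (hedge _ _ h))))
  have hnb : ∀ i v, D.underlying.Adj (f i) v → ∃ j, D'.underlying.Adj i j ∧ f j = v := by
    intro i v hv
    have h1 : ∑ v, D.adjInd (f i) v = (Finset.univ.filter (D.underlying.Adj (f i))).card := by
      rw [Finset.card_filter]
      push_cast
      refine Finset.sum_congr rfl fun v _ => ?_
      split_ifs with h
      · exact adjInd_eq_one.mpr h
      · exact adjInd_eq_zero.mpr h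
    -- The image of `s i` already fills the at most `k` places around `f i`; the range of `f` is
    -- therefore closed under adjacency.
    have h2 : (s i).image f = Finset.univ.filter (D.underlying.Adj (f i)) := by
      apply Finset.eq_of_subset_of_card_le
      · intro v hv
        obtain ⟨j, hj, rfl⟩ := Finset.mem_image.mp hv
        exact Finset.mem_filter.mpr ⟨Finset.mem_univ _, hadj _ _ (hs' i j hj)⟩
      · rw [Finset.card_image_of_injective _ hf]
        have := hD (f i)
        rw [h1] at this
        exact le_trans (by exact_mod_cast this) (hs i)
    have h3 : v ∈ (s i).image f := by
      rw [h2]; exact Finset.mem_filter.mpr ⟨Finset.mem_univ _, hv⟩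
    obtain ⟨j, hj, rfl⟩ := Finset.mem_image.mp h3
    exact ⟨j, hs' i j hj, rfl⟩
  have hsurj : Function.Surjective f := by
    intro v
    obtain ⟨p⟩ := hconn.preconnected v (f (Classical.arbitrary W))
    generalize hx : f (Classical.arbitrary W) = x at p
    replace hx : ∃ i, f i = x := ⟨_, hx⟩
    induction p with
    | nil => exact hx
    | cons h _ ih =>
      obtain ⟨i, rfl⟩ := ih hx
      obtain ⟨j, -, hj⟩ := hnb i _ h.symm
      exact ⟨j, hj⟩
  have hrefl : ∀ i j, D.underlying.Adj (f i) (f j) → D'.underlying.Adj i j := by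
    intro i j h
    obtain ⟨j', hj', h'⟩ := hnb i _ h
    rwa [← hf h']
  have harc' : ∀ i j, D.arc (f i) (f j) → D'.arc i j := by
    intro i j h
    rcases hrefl i j (Or.inl h) with h' | h' | h'
    · exact h'
    · exact absurd (harc _ _ h') (D.arc_asymm _ _ h)
    · exact absurd (hedge _ _ h') (D.arc_not_edge _ _ h)
  have hedge' : ∀ i j, D.edge.Adj (f i) (f j) → D'.edge.Adj i j := by
    intro i j h
    rcases hrefl i j (Or.inr (Or.inr h)) with h' | h' | h'
    · exact absurd h (D.arc_not_edge _ _ (harc _ _ h'))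
    · exact absurd h.symm (D.arc_not_edge _ _ (harc _ _ h'))
    · exact h'
  let e := Equiv.ofBijective f ⟨hf, hsurj⟩
  have he : ∀ u, f (e.symm u) = u := e.apply_symm_apply
  refine ⟨e.symm, fun u v => ⟨fun h => harc' _ _ ?_, fun h => ?_⟩,
    fun u v => ⟨fun h => hedge' _ _ ?_, fun h => ?_⟩⟩
  · rwa [he, he]
  · have := harc _ _ h
    rwa [he, he] at this
  · rwa [he, he]
  · have := hedge _ _ h
    rwa [he, he] at this

end Isomorphism

/-! ### Counting 2-paths in oriented graphs. -/

section Oriented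

variable {V : Type*} [Fintype V] {D : MixedGraph V}

open Classical in
/-- The number of directed paths `u → w → v`. -/
noncomputable def pathCount (D : MixedGraph V) (u v : V) : ℕ :=
  (Finset.univ.filter fun w => D.arc u w ∧ D.arc w v).card

open Classical in
/-- The number of common out-neighbours and common in-neighbours of `u` and `v`. -/
noncomputable def alignedCount (D : MixedGraph V) (u v : V) : ℕ :=
  (Finset.univ.filter fun w => (D.arc u w ∧ D.arc v w) ∨ (D.arc w u ∧ D.arc w v)).card

theorem pathCount_eq_sum (u v : V) :
    (D.pathCount u v : ℤ) = ∑ w, D.arcInd u w * D.arcInd w v := by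
  classical
  rw [pathCount, Finset.card_filter]
  push_cast
  refine Finset.sum_congr rfl fun w _ => ?_
  unfold arcInd
  split_ifs <;> simp_all

theorem alignedCount_eq_sum (u v : V) :
    (D.alignedCount u v : ℤ) = ∑ w, (D.arcInd u w * D.arcInd v w + D.arcInd w u * D.arcInd w v) := by
  classical
  rw [alignedCount, Finset.card_filter]
  push_cast
  refine Finset.sum_congr rfl fun w _ => ?_
  have := D.arc_asymm u w
  unfold arcInd
  split_ifs <;> simp_all

theorem edge_eq_bot_of_edgeDeg_eq_zero (h : ∀ w, D.edgeDeg w = 0) : D.edge = ⊥ := by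
  ext u v
  refine ⟨fun huv => ?_, fun huv => huv.elim⟩
  have := (Finset.sum_eq_zero_iff_of_nonneg fun _ _ => edgeInd_nonneg _ _).mp (h u) v
    (Finset.mem_univ v)
  rw [edgeInd_of_adj huv] at this
  omega

theorem exists_out_pair {u : V} (h : D.outDeg u = 2) :
    ∃ x y, x ≠ y ∧ ∀ z, D.arc u z ↔ z = x ∨ z = y := by
  classical
  have h1 : (Finset.univ.filter fun z => D.arc u z).card = 2 := by
    have : ((Finset.univ.filter fun z => D.arc u z).card : ℤ) = 2 := by
      rw [← h, outDeg, Finset.card_filter]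
      push_cast
      exact Finset.sum_congr rfl fun w _ => by unfold arcInd; split_ifs <;> rfl
    exact_mod_cast this
  obtain ⟨x, y, hxy, h2⟩ := Finset.card_eq_two.mp h1
  exact ⟨x, y, hxy, fun z => by simpa using Finset.ext_iff.mp h2 z⟩

theorem exists_in_pair {u : V} (h : D.inDeg u = 2) :
    ∃ x y, x ≠ y ∧ ∀ z, D.arc z u ↔ z = x ∨ z = y := by
  classical
  have h1 : (Finset.univ.filter fun z => D.arc z u).card = 2 := by
    have : ((Finset.univ.filter fun z => D.arc z u).card : ℤ) = 2 := by
      rw [← h, inDeg, Finset.card_filter]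
      push_cast
      exact Finset.sum_congr rfl fun w _ => by unfold arcInd; split_ifs <;> rfl
    exact_mod_cast this
  obtain ⟨x, y, hxy, h2⟩ := Finset.card_eq_two.mp h1
  exact ⟨x, y, hxy, fun z => by simpa using Finset.ext_iff.mp h2 z⟩

theorem exists_in_unique {u : V} (h : D.inDeg u = 1) : ∃ x, ∀ z, D.arc z u ↔ z = x := by
  classical
  have h1 : (Finset.univ.filter fun z => D.arc z u).card = 1 := by
    have : ((Finset.univ.filter fun z => D.arc z u).card : ℤ) = 1 := by
      rw [← h, inDeg, Finset.card_filter]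
      push_cast
      exact Finset.sum_congr rfl fun w _ => by unfold arcInd; split_ifs <;> rfl
    exact_mod_cast this
  obtain ⟨x, h2⟩ := Finset.card_eq_one.mp h1
  exact ⟨x, fun z => by simpa using Finset.ext_iff.mp h2 z⟩

variable [DecidableEq V] {a k : ℤ}

theorem WalkEquations.alignedCount_eq (h : D.WalkEquations a k) (he : D.edge = ⊥) (u v : V) :
    (D.alignedCount u v : ℤ) = D.pathCount u v + a * D.arcInd v u + if u = v then k else 0 := by
  have h1 := h.rat u v
  simp only [walkRat, edgeInd_of_edge_eq_bot he, mul_zero, zero_mul, add_zero, zero_add,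
    Finset.sum_sub_distrib] at h1
  rw [alignedCount_eq_sum, pathCount_eq_sum]
  linarith

theorem WalkEquations.pathCount_sub (h : D.WalkEquations a k) (he : D.edge = ⊥) (u v : V) :
    (D.pathCount u v : ℤ) - D.pathCount v u = a * (D.arcInd u v - D.arcInd v u) := by
  rw [← h.omega u v]
  simp only [walkOmega, edgeInd_of_edge_eq_bot he, mul_zero, zero_mul, add_zero, zero_add, sub_zero,
    Finset.sum_sub_distrib]
  rw [pathCount_eq_sum, pathCount_eq_sum]
  congr 1
  exact Finset.sum_congr rfl fun w _ => mul_comm _ _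

/-- Along an arc, common out-neighbours plus common in-neighbours equal the forward 2-paths. Summed
over arcs, each of the three terms counts the transitive triangles, so `T + T = T`. -/
theorem WalkEquations.not_transitive (h : D.WalkEquations a k) (he : D.edge = ⊥) {u v w : V}
    (huv : D.arc u v) (huw : D.arc u w) : ¬ D.arc w v := by
  intro hwv
  have key : ∀ u v, D.arcInd u v * (∑ w, (D.arcInd u w * D.arcInd v w + D.arcInd w u * D.arcInd w v))
      = D.arcInd u v * ∑ w, D.arcInd u w * D.arcInd w v := by
    intro u v
    rw [← alignedCount_eq_sum, ← pathCount_eq_sum, h.alignedCount_eq he]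
    by_cases hN : D.arc u v
    · rw [arcInd_of_not_arc (D.arc_asymm u v hN), if_neg]
      · ring
      · rintro rfl
        exact D.arc_asymm u u hN hN
    · rw [arcInd_of_not_arc hN]; ring
  have h1 : ∑ u, ∑ v, ∑ w, D.arcInd u v * (D.arcInd u w * D.arcInd v w) +
      ∑ u, ∑ v, ∑ w, D.arcInd u v * (D.arcInd w u * D.arcInd w v) =
      ∑ u, ∑ v, ∑ w, D.arcInd u v * (D.arcInd u w * D.arcInd w v) := by
    simp only [← Finset.sum_add_distrib]
    refine Finset.sum_congr rfl fun u _ => Finset.sum_congr rfl fun v _ => ?_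
    rw [← Finset.mul_sum, ← key u v, Finset.mul_sum]
    exact Finset.sum_congr rfl fun w _ => by ring
  have h2 : ∑ u, ∑ v, ∑ w, D.arcInd u v * (D.arcInd u w * D.arcInd v w) =
      ∑ u, ∑ v, ∑ w, D.arcInd u v * (D.arcInd u w * D.arcInd w v) := by
    refine Finset.sum_congr rfl fun u _ => ?_
    rw [Finset.sum_comm]
    exact Finset.sum_congr rfl fun v _ => Finset.sum_congr rfl fun w _ => by ring
  rw [h2, add_eq_left] at h1
  have hn : ∀ u v w, 0 ≤ D.arcInd u v * (D.arcInd w u * D.arcInd w v) := fun u v w =>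
    mul_nonneg (arcInd_nonneg _ _) (mul_nonneg (arcInd_nonneg _ _) (arcInd_nonneg _ _))
  rw [Finset.sum_eq_zero_iff_of_nonneg fun u _ => Finset.sum_nonneg fun v _ =>
    Finset.sum_nonneg fun w _ => hn u v w] at h1
  have h3 := h1 w (Finset.mem_univ _)
  rw [Finset.sum_eq_zero_iff_of_nonneg fun v _ => Finset.sum_nonneg fun x _ => hn w v x] at h3
  have h4 := h3 v (Finset.mem_univ _)
  rw [Finset.sum_eq_zero_iff_of_nonneg fun x _ => hn w v x] at h4
  have h5 := h4 u (Finset.mem_univ _)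
  rw [arcInd_of_arc huv, arcInd_of_arc huw, arcInd_of_arc hwv] at h5
  omega

theorem WalkEquations.pathCount_eq_zero (h : D.WalkEquations a k) (he : D.edge = ⊥) {u v : V}
    (huv : D.arc u v) : D.pathCount u v = 0 := by
  classical
  rw [pathCount, Finset.card_eq_zero, Finset.filter_eq_empty_iff]
  rintro w - ⟨h1, h2⟩
  exact h.not_transitive he huv h1 h2

theorem WalkEquations.pathCount_reverse (h : D.WalkEquations a k) (he : D.edge = ⊥) {u v : V}
    (huv : D.arc u v) : (D.pathCount v u : ℤ) = -a := by
  have h1 := h.pathCount_sub he u v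
  rw [h.pathCount_eq_zero he huv, arcInd_of_arc huv, arcInd_of_not_arc (D.arc_asymm _ _ huv)] at h1
  push_cast at h1
  linarith

/-- Two distinct vertices with a common neighbour have exactly one path of length two of each of the
three kinds between them. -/
def UniquePaths {V : Type*} (D : MixedGraph V) : Prop :=
  ∀ u v w, u ≠ v → (D.arc u w ∨ D.arc w u) → (D.arc v w ∨ D.arc w v) →
    (∃! x, D.arc u x ∧ D.arc x v) ∧ (∃! x, (D.arc u x ∧ D.arc v x) ∨ (D.arc x u ∧ D.arc x v))

/-- For `a = 0` the three kinds of 2-path are equally numerous. Their total is a positive multiple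
of three and at most `k ≤ 4`, hence three. -/
theorem WalkEquations.uniquePaths (h : D.WalkEquations 0 k) (he : D.edge = ⊥) (hk : k ≤ 4) :
    D.UniquePaths := by
  intro u v w huv hu hv
  have h1 := h.alignedCount_eq he u v
  have h2 := h.pathCount_sub he u v
  rw [if_neg huv] at h1
  have h3 : (D.pathCount u v : ℤ) + D.pathCount v u + D.alignedCount u v =
      ∑ x, D.adjInd u x * D.adjInd x v := by
    rw [pathCount_eq_sum, pathCount_eq_sum, alignedCount_eq_sum, ← Finset.sum_add_distrib,
      ← Finset.sum_add_distrib]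
    refine Finset.sum_congr rfl fun x _ => ?_
    simp only [adjInd, edgeInd_of_edge_eq_bot he]
    ring
  have h4 : ∑ x, D.adjInd u x * D.adjInd x v ≤ k := by
    rw [← h.sum_adjInd u]
    exact Finset.sum_le_sum fun x _ => mul_le_of_le_one_right (adjInd_nonneg _ _) (adjInd_le_one _ _)
  have h5 : 1 ≤ ∑ x, D.adjInd u x * D.adjInd x v := by
    have : D.adjInd u w * D.adjInd w v = 1 := by
      rw [adjInd_eq_one.mpr (hu.elim Or.inl fun h => Or.inr (Or.inl h)),
        adjInd_eq_one.mpr (hv.elim (fun h => Or.inr (Or.inl h)) Or.inl), mul_one]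
    rw [← this]
    exact Finset.single_le_sum (f := fun x => D.adjInd u x * D.adjInd x v)
      (fun x _ => mul_nonneg (adjInd_nonneg _ _) (adjInd_nonneg _ _)) (Finset.mem_univ w)
  have h6 : D.pathCount u v = 1 := by omega
  have h7 : D.alignedCount u v = 1 := by omega
  constructor
  · obtain ⟨x, hx⟩ := Finset.card_eq_one.mp h6
    simp only [Finset.ext_iff, Finset.mem_filter, Finset.mem_univ, true_and,
      Finset.mem_singleton] at hx
    exact ⟨x, (hx x).mpr rfl, fun y hy => (hx y).mp hy⟩
  · obtain ⟨x, hx⟩ := Finset.card_eq_one.mp h7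
    simp only [Finset.ext_iff, Finset.mem_filter, Finset.mem_univ, true_and,
      Finset.mem_singleton] at hx
    exact ⟨x, (hx x).mpr rfl, fun y hy => (hx y).mp hy⟩

end Oriented
end MixedGraph

/-! ### Recognising the triangle and the mixed 4-cycle. -/

namespace MixedGraph
section Recognition

variable {V : Type*} [Fintype V] {D : MixedGraph V}

theorem isIsomorphic_ofArcs {n : ℕ} [NeZero n] {l : List (Fin n × Fin n)}
    {h : ∀ u v, (u, v) ∈ l → (v, u) ∉ l} (hconn : D.Connected) {k : ℕ}
    (hD : ∀ u, ∑ v, D.adjInd u v ≤ k) (f : Fin n → V) (hf : Function.Injective f)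
    (hk : ∀ i, k ≤ (Finset.univ.filter fun j => (i, j) ∈ l ∨ (j, i) ∈ l).card)
    (harc : ∀ p ∈ l, D.arc (f p.1) (f p.2)) : D.IsIsomorphic (ofArcs l h) := by
  refine isIsomorphic_of_injective hconn hD f hf
    (fun i => Finset.univ.filter fun j => (i, j) ∈ l ∨ (j, i) ∈ l) hk ?_
    (fun i j hij => harc (i, j) hij) (fun i j hij => hij.elim)
  intro i j hij
  exact (Finset.mem_filter.mp hij).2.elim Or.inl fun h => Or.inr (Or.inl h)

theorem isIsomorphic_directedTriangle (hconn : D.Connected) (hD : ∀ u, ∑ v, D.adjInd u v ≤ 2)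
    {u v w : V} (huv : D.arc u v) (hvw : D.arc v w) (hwu : D.arc w u) :
    D.IsIsomorphic directedTriangle := by
  have irr := fun x h => D.arc_asymm x x h h
  refine isIsomorphic_ofArcs hconn (k := 2) hD ![u, v, w] ?_ (by decide) ?_
  · have h1 : u ≠ v := by rintro rfl; exact irr _ huv
    have h2 : v ≠ w := by rintro rfl; exact irr _ hvw
    have h3 : w ≠ u := by rintro rfl; exact irr _ hwu
    intro i j hij
    fin_cases i <;> fin_cases j <;> simp_all
  · simp [huv, hvw, hwu]

theorem isIsomorphic_mixedFourCycle (hconn : D.Connected) (hD : ∀ u, ∑ v, D.adjInd u v ≤ 2)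
    {x y z w : V} (hxz : x ≠ z) (hyw : y ≠ w) (hxy : D.arc x y) (hyz : D.arc y z) (hzw : D.arc z w)
    (hwx : D.edge.Adj w x) : D.IsIsomorphic mixedFourCycle := by
  have irr := fun x h => D.arc_asymm x x h h
  refine isIsomorphic_of_injective hconn (k := 2) hD ![x, y, z, w] ?_
    (fun i => {i + 1, i + 3}) (by decide) ?_ ?_ ?_
  · have h1 : x ≠ y := by rintro rfl; exact irr _ hxy
    have h2 : y ≠ z := by rintro rfl; exact irr _ hyz
    have h3 : z ≠ w := by rintro rfl; exact irr _ hzw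
    have h4 : w ≠ x := hwx.ne
    intro i j hij
    fin_cases i <;> fin_cases j <;> simp_all
  · simp only [underlying, mixedFourCycle, SimpleGraph.fromEdgeSet_adj, Set.mem_singleton_iff]
    decide
  · simp only [mixedFourCycle]
    intro i j
    fin_cases i <;> fin_cases j <;> simp [hxy, hyz, hzw]
  · intro i j
    simp only [mixedFourCycle, SimpleGraph.fromEdgeSet_adj, Set.mem_singleton_iff]
    rintro ⟨h, -⟩
    rcases Sym2.eq_iff.mp h with ⟨rfl, rfl⟩ | ⟨rfl, rfl⟩
    · exact hwx
    · exact hwx.symm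

end Recognition
end MixedGraph

/-! ### The 2-regular case, and vanishing of edges in the other cases. -/

namespace MixedGraph
section Classification

variable {V : Type*} [Fintype V] {D : MixedGraph V}

theorem isIsomorphic_mixedFourCycle_of_mixed_path (hconn : D.Connected)
    (hD : ∀ u, ∑ v, D.adjInd u v ≤ 2) {u v : V} (huv : u ≠ v)
    (h1 : ∃ w, D.arc v w ∧ D.arc w u)
    (h2 : ∃ w, (D.arc u w ∧ D.edge.Adj w v) ∨ (D.edge.Adj u w ∧ D.arc w v)) :
    D.IsIsomorphic mixedFourCycle := by
  obtain ⟨x, hvx, hxu⟩ := h1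
  obtain ⟨y, ⟨huy, hyv⟩ | ⟨huy, hyv⟩⟩ := h2
  · refine isIsomorphic_mixedFourCycle hconn hD huv.symm ?_ hvx hxu huy hyv
    rintro rfl
    exact D.arc_asymm _ _ hxu huy
  · refine isIsomorphic_mixedFourCycle hconn hD ?_ huv.symm hyv hvx hxu huy
    rintro rfl
    exact D.arc_asymm _ _ hyv hvx

theorem WalkEquations.isIsomorphic_mixedFourCycle [DecidableEq V] (h : D.WalkEquations 0 2)
    (hconn : D.Connected) : D.IsIsomorphic mixedFourCycle := by
  have hD : ∀ u, ∑ v, D.adjInd u v ≤ 2 := fun u => (h.sum_adjInd u).le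
  obtain ⟨u⟩ := hconn.nonempty
  have hex : ∀ w u, ∃ v, v ≠ u ∧ D.adjInd w v = 1 := by
    intro w u
    by_contra! hne
    have h1 := h.sum_adjInd w
    rw [← Finset.add_sum_erase _ _ (Finset.mem_univ u), Finset.sum_eq_zero] at h1
    · have := adjInd_le_one (D := D) w u
      omega
    · intro v hv
      have := hne v (Finset.ne_of_mem_erase hv)
      have := adjInd_le_one (D := D) w v
      have := adjInd_nonneg (D := D) w v
      omega
  obtain ⟨w, -, huw⟩ := hex u u
  obtain ⟨v, hvu, hwv⟩ := hex w u
  set p := ∑ w, D.arcInd u w * D.arcInd w v with hp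
  set q := ∑ w, D.arcInd v w * D.arcInd w u with hq
  set c := ∑ w, (D.edgeInd u w * D.edgeInd w v + D.arcInd u w * D.arcInd v w +
    D.arcInd w u * D.arcInd w v) with hc
  set x := ∑ w, (D.arcInd u w * D.edgeInd w v + D.edgeInd u w * D.arcInd w v) with hx
  set y := ∑ w, (D.arcInd v w * D.edgeInd w u + D.edgeInd v w * D.arcInd w u) with hy
  have h1 : c + y - p = 0 := by
    have := h.rat u v
    rw [if_neg hvu.symm, zero_mul, add_zero] at this
    rw [← this, walkRat, hc, hy, hp,
      ← Finset.sum_add_distrib, ← Finset.sum_sub_distrib]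
    refine Finset.sum_congr rfl fun w _ => ?_
    rw [edgeInd_comm w u, edgeInd_comm v w]
    ring
  have h2 : x - y + p - q = 0 := by
    rw [← zero_mul (D.arcInd u v - D.arcInd v u), ← h.omega u v, walkOmega, hx, hy, hp, hq,
      ← Finset.sum_sub_distrib, ← Finset.sum_add_distrib, ← Finset.sum_sub_distrib]
    refine Finset.sum_congr rfl fun w _ => ?_
    rw [edgeInd_comm w u, edgeInd_comm v w]
    ring
  have h3 : p + q + c + x + y = ∑ w, D.adjInd u w * D.adjInd w v := by
    rw [hp, hq, hc, hx, hy, ← Finset.sum_add_distrib, ← Finset.sum_add_distrib,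
      ← Finset.sum_add_distrib, ← Finset.sum_add_distrib]
    refine Finset.sum_congr rfl fun w _ => ?_
    rw [adjInd, adjInd, edgeInd_comm w u, edgeInd_comm v w]
    ring
  have h4 : ∑ w, D.adjInd u w * D.adjInd w v ≤ 2 := by
    rw [← h.sum_adjInd u]
    exact Finset.sum_le_sum fun x _ => mul_le_of_le_one_right (adjInd_nonneg _ _) (adjInd_le_one _ _)
  have h5 : 1 ≤ ∑ w, D.adjInd u w * D.adjInd w v := by
    have h6 : D.adjInd u w * D.adjInd w v = 1 := by rw [huw, hwv, mul_one]
    rw [← h6]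
    exact Finset.single_le_sum (f := fun x => D.adjInd u x * D.adjInd x v)
      (fun x _ => mul_nonneg (adjInd_nonneg _ _) (adjInd_nonneg _ _)) (Finset.mem_univ w)
  have hN := fun u v => arcInd_nonneg (D := D) u v
  have hE := fun u v => edgeInd_nonneg (D := D) u v
  have hc0 : 0 ≤ c := Finset.sum_nonneg fun w _ => by
    have := mul_nonneg (hE u w) (hE w v)
    have := mul_nonneg (hN u w) (hN v w)
    have := mul_nonneg (hN w u) (hN w v)
    omega
  have hx0 : ∀ u v, 0 ≤ ∑ w, (D.arcInd u w * D.edgeInd w v + D.edgeInd u w * D.arcInd w v) :=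
    fun u v => Finset.sum_nonneg fun w _ => by
      have := mul_nonneg (hN u w) (hE w v)
      have := mul_nonneg (hE u w) (hN w v)
      omega
  have hx1 := hx0 u v
  have hy1 := hx0 v u
  have path : ∀ u v, ∑ w, D.arcInd u w * D.arcInd w v = 1 → ∃ w, D.arc u w ∧ D.arc w v := by
    intro u v hs
    by_contra! hne
    rw [Finset.sum_eq_zero] at hs
    · omega
    · intro w _
      by_cases hw : D.arc u w
      · rw [arcInd_of_not_arc (hne w hw), mul_zero]
      · rw [arcInd_of_not_arc hw, zero_mul]
  have mixed : ∀ u v, ∑ w, (D.arcInd u w * D.edgeInd w v + D.edgeInd u w * D.arcInd w v) = 1 →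
      ∃ w, (D.arc u w ∧ D.edge.Adj w v) ∨ (D.edge.Adj u w ∧ D.arc w v) := by
    intro u v hs
    by_contra! hne
    rw [Finset.sum_eq_zero] at hs
    · omega
    · intro w _
      have h1 : D.arcInd u w * D.edgeInd w v = 0 := by
        by_cases hw : D.arc u w
        · rw [edgeInd_of_not_adj ((hne w).1 hw), mul_zero]
        · rw [arcInd_of_not_arc hw, zero_mul]
      have h2 : D.edgeInd u w * D.arcInd w v = 0 := by
        by_cases hw : D.edge.Adj u w
        · rw [arcInd_of_not_arc ((hne w).2 hw), mul_zero]
        · rw [edgeInd_of_not_adj hw, zero_mul]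
      omega
  -- Here `p = c + y` and `q = c + x`, so the total is `3 * c + 2 * x + 2 * y`. Being `1` or `2`, it
  -- forces `c = 0` and `x + y = 1`.
  have h7 : (x = 1 ∧ q = 1) ∨ (y = 1 ∧ p = 1) := by omega
  rcases h7 with ⟨h7, h8⟩ | ⟨h7, h8⟩
  · exact isIsomorphic_mixedFourCycle_of_mixed_path hconn hD hvu.symm (path v u h8) (mixed u v h7)
  · exact isIsomorphic_mixedFourCycle_of_mixed_path hconn hD hvu (path u v h8) (mixed v u h7)

/-- Substituting `2 * a = k - 4` turns the degree form into `e * (k + e + 4) + 3 * (o - i) ^ 2`, a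
sum of nonnegative terms. -/
theorem edge_eq_bot_of_degree_eq_two_mul [DecidableEq V] {a k : ℤ} (h : D.WalkEquations a k)
    (hkpos : 0 < k) (hk : k = 2 * (a + 2)) :
    D.edge = ⊥ ∧ ∀ w, D.outDeg w = a + 2 ∧ D.inDeg w = a + 2 := by
  have h1 := h.sum_degree_form
  have h2 : ∀ w, (k + D.edgeDeg w) ^ 2 + 3 * (D.outDeg w - D.inDeg w) ^ 2
      - 2 * a * (k + D.edgeDeg w) - 4 * k =
      D.edgeDeg w * (k + D.edgeDeg w + 4) + 3 * (D.outDeg w - D.inDeg w) ^ 2 := by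
    intro w
    have : 2 * a = k - 4 := by omega
    rw [this]
    ring
  simp only [h2] at h1
  have he := fun w => edgeDeg_nonneg (D := D) w
  have h3 : ∀ w, 0 ≤ D.edgeDeg w * (k + D.edgeDeg w + 4) := fun w =>
    mul_nonneg (he w) (by have := he w; omega)
  rw [Finset.sum_eq_zero_iff_of_nonneg fun w _ => add_nonneg (h3 w) (by positivity)] at h1
  have h4 : ∀ w, D.edgeDeg w = 0 ∧ D.outDeg w - D.inDeg w = 0 := by
    intro w
    have h5 := h1 w (Finset.mem_univ w)
    have h6 := h3 w
    have h7 := sq_nonneg (D.outDeg w - D.inDeg w)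
    have h8 : D.edgeDeg w * (k + D.edgeDeg w + 4) = 0 := by omega
    have h9 : (D.outDeg w - D.inDeg w) ^ 2 = 0 := by omega
    have := he w
    exact ⟨(mul_eq_zero.mp h8).resolve_right (by omega), by simpa using h9⟩
  refine ⟨edge_eq_bot_of_edgeDeg_eq_zero fun w => (h4 w).1, fun w => ?_⟩
  have := h.degree_eq w
  have := h4 w
  omega

/-- The summand `(3 + e) ^ 2 + 3 * (o - i) ^ 2 - 12` is positive if `e > 0`; if `e = 0`, then `o -
i` is odd, and zero occurs exactly when it is `±1`. -/
theorem edge_eq_bot_of_degree_eq_three [DecidableEq V] (h : D.WalkEquations 0 3) :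
    D.edge = ⊥ ∧ ∀ w, (D.outDeg w = 2 ∧ D.inDeg w = 1) ∨ (D.outDeg w = 1 ∧ D.inDeg w = 2) := by
  have h1 := h.sum_degree_form
  have h2 : ∀ w, 0 ≤ (3 + D.edgeDeg w) ^ 2 + 3 * (D.outDeg w - D.inDeg w) ^ 2
      - 2 * 0 * (3 + D.edgeDeg w) - 4 * 3 ∧
      ((3 + D.edgeDeg w) ^ 2 + 3 * (D.outDeg w - D.inDeg w) ^ 2
      - 2 * 0 * (3 + D.edgeDeg w) - 4 * 3 = 0 → D.edgeDeg w = 0 ∧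
      ((D.outDeg w = 2 ∧ D.inDeg w = 1) ∨ (D.outDeg w = 1 ∧ D.inDeg w = 2))) := by
    intro w
    have h3 := h.degree_eq w
    have h4 := edgeDeg_nonneg (D := D) w
    have h5 := outDeg_nonneg (D := D) w
    have h6 := inDeg_nonneg (D := D) w
    generalize D.edgeDeg w = e at *
    generalize D.outDeg w = o at *
    generalize D.inDeg w = i at *
    have : e ≤ 3 := by omega
    have : o ≤ 3 := by omega
    obtain rfl : i = 3 - e - o := by omega
    interval_cases e <;> interval_cases o <;> omega
  rw [Finset.sum_eq_zero_iff_of_nonneg fun w _ => (h2 w).1] at h1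
  have h3 := fun w => (h2 w).2 (h1 w (Finset.mem_univ w))
  exact ⟨edge_eq_bot_of_edgeDeg_eq_zero fun w => (h3 w).1, fun w => (h3 w).2⟩

end Classification
end MixedGraph

/-! ### Uniqueness of the orientation of `K_{3,3}`. -/

namespace MixedGraph
section Uniqueness

variable {V : Type*} [Fintype V] {D : MixedGraph V}

theorem isIsomorphic_specialK33 (hconn : D.Connected) (hD : ∀ u, ∑ v, D.adjInd u v ≤ 3)
    (hp : D.UniquePaths) (hdeg : ∀ w, (D.outDeg w = 2 ∧ D.inDeg w = 1) ∨
      (D.outDeg w = 1 ∧ D.inDeg w = 2)) : D.IsIsomorphic specialK33 := by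
  have hex : ∃ u, D.outDeg u = 2 ∧ D.inDeg u = 1 := by
    by_contra! hne
    have h1 : ∑ w, D.outDeg w < ∑ w, D.inDeg w := by
      obtain ⟨u⟩ := hconn.nonempty
      refine Finset.sum_lt_sum_of_nonempty ⟨u, Finset.mem_univ u⟩ fun w _ => ?_
      have := hdeg w
      have := hne w
      omega
    exact h1.ne sum_outDeg_eq_sum_inDeg
  obtain ⟨u, ho, hi⟩ := hex
  obtain ⟨x, y, hxy, hout⟩ := exists_out_pair ho
  obtain ⟨z, hin⟩ := exists_in_unique hi
  have irr := fun x h => D.arc_asymm x x h h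
  have asymm := D.arc_asymm
  have hux := (hout x).mpr (Or.inl rfl)
  have huy := (hout y).mpr (Or.inr rfl)
  have hzu := (hin z).mpr rfl
  have hnb : ∃ v w, v ≠ w ∧ v ≠ u ∧ w ≠ u ∧ (D.arc v z ∨ D.arc z v) ∧ (D.arc w z ∨ D.arc z w) := by
    rcases hdeg z with ⟨ho, hi⟩ | ⟨-, hi⟩
    · obtain ⟨p, q, hpq, hpq'⟩ := exists_out_pair ho
      obtain ⟨r, hr⟩ := exists_in_unique hi
      have hr' := (hr r).mpr rfl
      rcases (hpq' u).mp hzu with rfl | rfl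
      · have hq := (hpq' q).mpr (Or.inr rfl)
        refine ⟨q, r, ?_, hpq.symm, ?_, Or.inr hq, Or.inl hr'⟩
        · rintro rfl; exact asymm _ _ hr' hq
        · rintro rfl; exact asymm _ _ hr' hzu
      · have hq := (hpq' p).mpr (Or.inl rfl)
        refine ⟨p, r, ?_, hpq, ?_, Or.inr hq, Or.inl hr'⟩
        · rintro rfl; exact asymm _ _ hr' hq
        · rintro rfl; exact asymm _ _ hr' hzu
    · obtain ⟨p, q, hpq, hpq'⟩ := exists_in_pair hi
      have h1 := (hpq' p).mpr (Or.inl rfl)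
      have h2 := (hpq' q).mpr (Or.inr rfl)
      refine ⟨p, q, hpq, ?_, ?_, Or.inl h1, Or.inl h2⟩
      · rintro rfl; exact asymm _ _ h1 hzu
      · rintro rfl; exact asymm _ _ h2 hzu
  obtain ⟨v, w, hvw, hvu, hwu, hvz, hwz⟩ := hnb
  -- A path from `v` to `u` must end with `z → u`, so `v → z`. The path from `u` to `v` and the
  -- aligned neighbour then use `x` and `y`, one each.
  have key : ∀ v, v ≠ u → (D.arc v z ∨ D.arc z v) →
      D.arc v z ∧ ((D.arc x v ∧ D.arc v y) ∨ (D.arc y v ∧ D.arc v x)) := by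
    intro v hvu hvz
    obtain ⟨⟨p, hp1, hp2⟩, ⟨q, hq1, hq2⟩⟩ := hp u v z hvu.symm (Or.inr hzu) hvz
    obtain ⟨⟨r, hr1, hr2⟩, -⟩ := hp v u z hvu hvz (Or.inr hzu)
    simp only [hout, hin] at *
    grind
  obtain ⟨hvz', hv⟩ := key v hvu hvz
  obtain ⟨hwz', hw⟩ := key w hwu hwz
  obtain ⟨-, q, hq1, hq2⟩ := hp v w z hvw hvz hwz
  have fin : ∀ v w, v ≠ w → v ≠ u → w ≠ u → D.arc v z → D.arc w z → D.arc x v → D.arc v y →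
      D.arc y w → D.arc w x → D.IsIsomorphic specialK33 := by
    intro v w hvw hvu hwu hvz hwz hxv hvy hyw hwx
    refine isIsomorphic_ofArcs hconn (k := 3) hD ![u, v, w, x, y, z] ?_ (by decide) ?_
    · have h1 : x ≠ z := by rintro rfl; exact asymm _ _ hux hzu
      have h2 : y ≠ z := by rintro rfl; exact asymm _ _ huy hzu
      rw [← List.nodup_ofFn]
      simp
      grind
    · simp [hux, huy, hzu, hvz, hwz, hxv, hvy, hyw, hwx]
  -- `z` is already the aligned neighbour of `v` and `w`, so they cannot be passed in the same
  -- direction between `x` and `y`.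
  grind
end Uniqueness
end MixedGraph

/-! ### Uniqueness of the orientation of `K_{5,5}` minus a perfect matching. -/

namespace MixedGraph
section UniquenessK55

variable {V : Type*} {D : MixedGraph V}

theorem UniquePaths.path_unique (hp : D.UniquePaths) {u v x y : V} (huv : u ≠ v)
    (hx : D.arc u x ∧ D.arc x v) (hy : D.arc u y ∧ D.arc y v) : x = y :=
  (hp u v x huv (Or.inl hx.1) (Or.inr hx.2)).1.unique hx hy

theorem UniquePaths.aligned_unique (hp : D.UniquePaths) {u v x y : V} (huv : u ≠ v)
    (hx : (D.arc u x ∧ D.arc v x) ∨ (D.arc x u ∧ D.arc x v))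
    (hy : (D.arc u y ∧ D.arc v y) ∨ (D.arc y u ∧ D.arc y v)) : x = y :=
  (hp u v x huv (hx.imp And.left And.left) (hx.imp And.right And.right)).2.unique hx hy

variable [Fintype V]

theorem isIsomorphic_specialK55 (hconn : D.Connected) (hD : ∀ u, ∑ v, D.adjInd u v ≤ 4)
    (hp : D.UniquePaths) (htrans : ∀ u v w, D.arc u v → D.arc u w → ¬ D.arc w v)
    (hout : ∀ w, D.outDeg w = 2) (hin : ∀ w, D.inDeg w = 2) : D.IsIsomorphic specialK55 := by
  have asymm := D.arc_asymm
  have irr := fun x h => D.arc_asymm x x h h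
  obtain ⟨u⟩ := hconn.nonempty
  -- the neighbours of the base vertex
  obtain ⟨x₁, x₂, hx, hux⟩ := exists_out_pair (hout u)
  obtain ⟨y₁, y₂, hy, hyu⟩ := exists_in_pair (hin u)
  have hux₁ := (hux x₁).mpr (Or.inl rfl)
  have hux₂ := (hux x₂).mpr (Or.inr rfl)
  have hyu₁ := (hyu y₁).mpr (Or.inl rfl)
  have hyu₂ := (hyu y₂).mpr (Or.inr rfl)
  have other : ∀ w z, D.arc w z → ∃ z', z' ≠ z ∧ ∀ t, D.arc w t ↔ t = z ∨ t = z' := by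
    intro w z hz
    obtain ⟨p, q, hpq, hpq'⟩ := exists_out_pair (hout w)
    rcases (hpq' z).mp hz with rfl | rfl
    · exact ⟨q, hpq.symm, hpq'⟩
    · exact ⟨p, hpq, fun t => (hpq' t).trans or_comm⟩
  have other' : ∀ w z, D.arc z w → ∃ z', z' ≠ z ∧ ∀ t, D.arc t w ↔ t = z ∨ t = z' := by
    intro w z hz
    obtain ⟨p, q, hpq, hpq'⟩ := exists_in_pair (hin w)
    rcases (hpq' z).mp hz with rfl | rfl
    · exact ⟨q, hpq.symm, hpq'⟩
    · exact ⟨p, hpq, fun t => (hpq' t).trans or_comm⟩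
  -- an out-neighbour of an in-neighbour of `u`
  have keyY : ∀ y y' a, D.arc y u → D.arc y' u → y ≠ y' → (∀ t, D.arc t u ↔ t = y ∨ t = y') →
      a ≠ u → D.arc y a → D.arc a y' ∧ ∃ x, D.arc u x ∧ D.arc x a ∧
        ∀ t, D.arc u t → t ≠ x → ¬ D.arc t a ∧ ¬ D.arc a t := by
    intro y y' a hy hy' hyy hin hau hya
    obtain ⟨⟨x, ⟨hx1, hx2⟩, hx3⟩, ⟨q, hq1, hq2⟩⟩ := hp u a y hau.symm (Or.inr hy) (Or.inr hya)
    obtain ⟨⟨r, ⟨hr1, hr2⟩, hr3⟩, -⟩ := hp a u y hau (Or.inr hya) (Or.inr hy)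
    have hr : r = y' := by
      rcases (hin r).mp hr2 with rfl | rfl
      · exact absurd hr1 (asymm _ _ hya)
      · rfl
    subst hr
    refine ⟨hr1, x, hx1, hx2, fun t ht htx => ⟨fun h => htx (hx3 t ⟨ht, h⟩), fun h => ?_⟩⟩
    -- `y` is already the aligned neighbour of `u` and `a`.
    have h1 := hp.aligned_unique hau.symm (Or.inl ⟨ht, h⟩) (Or.inr ⟨hy, hya⟩)
    subst h1
    exact asymm _ _ ht hy
  obtain ⟨a, hau, hy₁a⟩ := other y₁ u hyu₁
  obtain ⟨b, hbu, hy₂b⟩ := other y₂ u hyu₂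
  have hy₁a' := (hy₁a a).mpr (Or.inr rfl)
  have hy₂b' := (hy₂b b).mpr (Or.inr rfl)
  obtain ⟨hay₂, p, hup, hpa, hna⟩ := keyY y₁ y₂ a hyu₁ hyu₂ hy hyu hau hy₁a'
  obtain ⟨hby₁, r, hur, hrb, hnb⟩ := keyY y₂ y₁ b hyu₂ hyu₁ hy.symm
    (fun t => (hyu t).trans or_comm) hbu hy₂b'
  have hab : a ≠ b := by rintro rfl; exact asymm _ _ hay₂ hy₂b'
  -- an out-neighbour of an out-neighbour of `u`
  have keyX : ∀ x x' c, D.arc u x → D.arc u x' → x ≠ x' → (∀ t, D.arc u t ↔ t = x ∨ t = x') →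
      D.arc x c → c ≠ a → c ≠ b → D.arc c x' ∧ (D.arc c y₁ ∨ D.arc c y₂) := by
    intro x x' c hx hx' hxx hux hxc hca hcb
    have hcu : c ≠ u := by rintro rfl; exact asymm _ _ hx hxc
    obtain ⟨-, ⟨q, hq1, hq2⟩⟩ := hp u c x hcu.symm (Or.inl hx) (Or.inr hxc)
    obtain ⟨⟨r, ⟨hr1, hr2⟩, hr3⟩, -⟩ := hp c u x hcu (Or.inr hxc) (Or.inl hx)
    refine ⟨?_, ?_⟩
    · rcases hq1 with ⟨h1, h2⟩ | ⟨h1, h2⟩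
      · rcases (hux q).mp h1 with rfl | rfl
        · exact absurd h2 (asymm _ _ hxc)
        · exact h2
      · rcases (hyu q).mp h1 with rfl | rfl
        · rcases (hy₁a c).mp h2 with h | h
          · exact absurd h hcu
          · exact absurd h hca
        · rcases (hy₂b c).mp h2 with h | h
          · exact absurd h hcu
          · exact absurd h hcb
    · rcases (hyu r).mp hr2 with rfl | rfl
      · exact Or.inl hr1
      · exact Or.inr hr1
  -- If they agreed, the other out-neighbour `q` of `u` would miss both `a` and `b`. By `keyX` both
  -- out-neighbours of `q` would then point to `p`, giving them two aligned neighbours, `q` and `p`.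
  have hpr : p ≠ r := by
    rintro rfl
    obtain ⟨q, hq, huq⟩ := other u p hup
    have huq' := (huq q).mpr (Or.inr rfl)
    obtain ⟨c, d, hcd, hqc⟩ := exists_out_pair (hout q)
    have hqc' := (hqc c).mpr (Or.inl rfl)
    have hqd' := (hqc d).mpr (Or.inr rfl)
    have hA := hna q huq' hq
    have hB := hnb q huq' hq
    have hc := keyX q p c huq' hup hq (fun t => (huq t).trans or_comm) hqc'
      (fun h => hA.1 (h ▸ hqc')) (fun h => hB.1 (h ▸ hqc'))
    have hd := keyX q p d huq' hup hq (fun t => (huq t).trans or_comm) hqd'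
      (fun h => hA.1 (h ▸ hqd')) (fun h => hB.1 (h ▸ hqd'))
    have := hp.aligned_unique hcd (Or.inr ⟨hqc', hqd'⟩) (Or.inl ⟨hc.1, hd.1⟩)
    exact hq this
  have hup' : ∀ t, D.arc u t ↔ t = r ∨ t = p := by grind
  have hA := hna r hur hpr.symm
  have hB := hnb p hup hpr
  obtain ⟨c, hcb, hrc⟩ := other r b hrb
  obtain ⟨d, hda, hpd⟩ := other p a hpa
  have hrc' := (hrc c).mpr (Or.inr rfl)
  have hpd' := (hpd d).mpr (Or.inr rfl)
  have hca : c ≠ a := by rintro rfl; exact hA.1 hrc'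
  have hdb : d ≠ b := by rintro rfl; exact hB.1 hpd'
  obtain ⟨hcp, hcy⟩ := keyX r p c hur hup hpr.symm hup' hrc' hca hcb
  obtain ⟨hdr, hdy⟩ := keyX p r d hup hur hpr (fun t => (hup' t).trans or_comm) hpd' hda hdb
  have hpy₁ : p ≠ y₁ := by rintro rfl; exact asymm _ _ hup hyu₁
  have hpy₂ : p ≠ y₂ := by rintro rfl; exact asymm _ _ hup hyu₂
  have hry₁ : r ≠ y₁ := by rintro rfl; exact asymm _ _ hur hyu₁
  have hry₂ : r ≠ y₂ := by rintro rfl; exact asymm _ _ hur hyu₂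
  have hcy₂ : D.arc c y₂ := hcy.resolve_left fun h =>
    hpy₁ (hp.path_unique hca ⟨hcp, hpa⟩ ⟨h, hy₁a'⟩)
  have hdy₁ : D.arc d y₁ := hdy.resolve_right fun h =>
    hry₂ (hp.path_unique hdb ⟨hdr, hrb⟩ ⟨h, hy₂b'⟩)
  have hcd : c ≠ d := by rintro rfl; exact asymm _ _ hcp hpd'
  -- the vertex at distance three from `u`
  obtain ⟨z, hzy₂, haz⟩ := other a y₂ hay₂
  have haz' := (haz z).mpr (Or.inr rfl)
  have hcu : c ≠ u := by rintro rfl; exact asymm _ _ hur hrc'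
  have hdu : d ≠ u := by rintro rfl; exact asymm _ _ hup hpd'
  have hzc : D.arc z c := by
    obtain ⟨⟨w, ⟨h1, h2⟩, -⟩, -⟩ := hp a c p hca.symm (Or.inr hpa) (Or.inl hcp)
    rcases (haz w).mp h1 with rfl | rfl
    · exact absurd h2 (asymm _ _ hcy₂)
    · exact h2
  have hzd : D.arc z d := by
    obtain ⟨⟨w, ⟨h1, h2⟩, -⟩, -⟩ := hp a d p hda.symm (Or.inr hpa) (Or.inr hpd')
    rcases (haz w).mp h1 with rfl | rfl
    · rcases (hy₂b d).mp h2 with h | h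
      · exact absurd h hdu
      · exact absurd h hdb
    · exact h2
  have hrz : r ≠ z := by rintro rfl; exact hA.2 haz'
  -- The in-neighbours of `c` are `r` and `z`, and `r → b` rules out `r` on the path from `b` to
  -- `c`.
  have hbz : D.arc b z := by
    obtain ⟨⟨w, ⟨h1, h2⟩, -⟩, -⟩ := hp b c r hcb.symm (Or.inr hrb) (Or.inr hrc')
    obtain ⟨c', hc', hc''⟩ := other' c r hrc'
    rcases (hc'' w).mp h2 with rfl | rfl
    · exact absurd h1 (asymm _ _ hrb)
    · rcases (hc'' z).mp hzc with h | rfl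
      · exact absurd h.symm hrz
      · exact h1
  have huz : u ≠ z := by rintro rfl; exact htrans _ _ _ hzc hur hrc'
  have har : a ≠ r := by rintro rfl; exact htrans _ _ _ hur hup hpa
  have hbp : b ≠ p := by rintro rfl; exact htrans _ _ _ hup hur hrb
  have hcy₁ : c ≠ y₁ := by rintro rfl; exact htrans _ _ _ hcp hyu₁ hup
  have hdy₂ : d ≠ y₂ := by rintro rfl; exact htrans _ _ _ hdr hyu₂ hur
  have hzp : z ≠ p := by rintro rfl; exact asymm _ _ hzc hcp
  have hzy₁ : z ≠ y₁ := by rintro rfl; exact asymm _ _ hy₁a' haz'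
  have ne : ∀ {s t}, D.arc s t → s ≠ t := by rintro s _ h rfl; exact irr s h
  refine isIsomorphic_ofArcs hconn (k := 4) hD ![u, a, b, c, d, z, r, p, y₁, y₂] ?_ (by decide) ?_
  · rw [← List.nodup_ofFn]
    simp [hau.symm, hbu.symm, hcu.symm, hdu.symm, huz, ne hur, ne hup, (ne hyu₁).symm,
      (ne hyu₂).symm, hab, hca.symm, hda.symm, ne haz', har, (ne hpa).symm, (ne hy₁a').symm,
      ne hay₂, hcb.symm, hdb.symm, ne hbz, (ne hrb).symm, hbp, ne hby₁, (ne hy₂b').symm, hcd,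
      (ne hzc).symm, (ne hrc').symm, ne hcp, hcy₁, ne hcy₂, (ne hzd).symm, ne hdr, (ne hpd').symm,
      ne hdy₁, hdy₂, hrz.symm, hzp, hzy₁, hzy₂, hpr.symm, hry₁, hry₂, hpy₁, hpy₂, hy]
  · simp [hur, hup, hyu₁, hyu₂, haz', hay₂, hbz, hby₁, hcp, hcy₂, hdr, hdy₁, hzc, hzd, hrb, hrc',
      hpa, hpd', hy₁a', hy₂b']

end UniquenessK55
end MixedGraph

/-! ### Assembly of the cases. -/

theorem mainTheorem2 {V : Type*} [Fintype V] [DecidableEq V] (D : MixedGraph V)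
    (hconn : D.Connected) (htwo : (spectrum ℂ D.hermAdj).ncard = 2) :
    (D.underlying = ⊤ ∧ 2 ≤ Fintype.card V ∧
        D.hermAdj.charpoly = (MixedGraph.ofGraph (⊤ : SimpleGraph V)).hermAdj.charpoly) ∨
      D.IsIsomorphic MixedGraph.mixedFourCycle ∨
      ((D.IsIsomorphic MixedGraph.directedEdge ∧ spectrum ℂ D.hermAdj = {1, -1}) ∨
        (D.IsIsomorphic MixedGraph.directedTriangle ∧ spectrum ℂ D.hermAdj = {1, -2}) ∨
        (D.IsIsomorphic MixedGraph.specialK33 ∧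
          spectrum ℂ D.hermAdj = {(Real.sqrt 3 : ℂ), -(Real.sqrt 3 : ℂ)}) ∨
        (D.IsIsomorphic MixedGraph.specialK55 ∧ spectrum ℂ D.hermAdj = {2, -2})) := by
  classical
  have hne : Nonempty V := hconn.nonempty
  obtain ⟨s, t, hst, hspec, heig⟩ :=
    MixedGraph.exists_eigenvalue_pair MixedGraph.isHermitian_hermAdj htwo
  have hsq := MixedGraph.mul_self_of_eigenvalues MixedGraph.isHermitian_hermAdj heig
  have hadj : ∃ u v, D.underlying.Adj u v := by
    by_contra! hadj
    have h0 : D.hermAdj = 0 := by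
      ext u v
      have := hadj u v
      simp only [MixedGraph.underlying, not_or] at this
      simp [MixedGraph.hermAdj, this]
    rw [h0, spectrum.zero_eq, Set.ncard_singleton] at htwo
    omega
  obtain ⟨u, v, huv⟩ := hadj
  obtain ⟨a, k, ha, hk, h⟩ := MixedGraph.exists_walkEquations huv hsq
  have hkpos : 0 < k := by
    have h1 := h.sum_adjInd u
    have h2 := Finset.single_le_sum (f := fun x => D.adjInd u x)
      (fun x _ => MixedGraph.adjInd_nonneg _ _) (Finset.mem_univ v)
    rw [MixedGraph.adjInd_eq_one.mpr huv, h1] at h2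
    omega
  have hD : ∀ u, ∑ v, D.adjInd u v ≤ k := fun u => (h.sum_adjInd u).le
  have hint := MixedGraph.eigenvalue_integral MixedGraph.isHermitian_hermAdj
    MixedGraph.trace_hermAdj heig ha hk
  rcases h.parameters hkpos hst ha hk hint with ⟨rfl, rfl, rfl⟩ | ⟨rfl, hka⟩ | ⟨rfl, rfl | rfl⟩
  -- The directed edge, with eigenvalues `±1`, is absorbed here as a complete graph on two vertices.
  · left
    have htop := h.underlying_eq_top hconn
    exact ⟨htop, Fintype.one_lt_card_iff.mpr ⟨u, v, huv.ne⟩,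
      MixedGraph.charpoly_eq_of_underlying_eq_top htop h.sum_adjInd hsq⟩
  · right; right; right
    obtain ⟨he, hdeg⟩ := MixedGraph.edge_eq_bot_of_degree_eq_two_mul h hkpos hka
    have harc : ∃ x y, D.arc x y := by
      rcases huv with huv | huv | huv
      · exact ⟨_, _, huv⟩
      · exact ⟨_, _, huv⟩
      · simp [he] at huv
    obtain ⟨x, y, hxy⟩ := harc
    have hpath := h.pathCount_reverse he hxy
    have ht : t = a + 2 := by linarith
    -- `-a` counts paths, so `a ≤ 0`; and `0 < k = 2 * (a + 2)` gives `a > -2`.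
    have ha2 : a = -1 ∨ a = 0 := by omega
    rcases ha2 with rfl | rfl
    · left
      have hpos : 0 < D.pathCount y x := by omega
      obtain ⟨z, hz⟩ := Finset.card_pos.mp hpos
      obtain ⟨-, hyz, hzx⟩ := Finset.mem_filter.mp hz
      refine ⟨MixedGraph.isIsomorphic_directedTriangle hconn (by simpa [hka] using hD) hxy hyz hzx,
        ?_⟩
      rw [hspec, ht]
      norm_num
    · right; right
      obtain rfl : k = 4 := by omega
      refine ⟨MixedGraph.isIsomorphic_specialK55 hconn hD (h.uniquePaths he le_rfl)
        (fun _ _ _ => h.not_transitive he) (fun w => (hdeg w).1) (fun w => (hdeg w).2), ?_⟩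
      rw [hspec, ht]
      norm_num
  · exact Or.inr (Or.inl (h.isIsomorphic_mixedFourCycle hconn))
  · right; right; right; right; left
    obtain ⟨he, hdeg⟩ := MixedGraph.edge_eq_bot_of_degree_eq_three h
    refine ⟨MixedGraph.isIsomorphic_specialK33 hconn hD (h.uniquePaths he (by norm_num)) hdeg, ?_⟩
    have hts : s = -t := by push_cast at ha; linarith
    have ht : t = Real.sqrt 3 := by
      rw [eq_comm, Real.sqrt_eq_iff_mul_self_eq_of_pos (by linarith)]
      rw [hts] at hk
      push_cast at hk
      linarith
    rw [hspec, hts, ht, Complex.ofReal_neg]
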